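/- Let $n\ge 2$ and let $S\subset\mathbb{R}^n$ be a smooth embedded hypersurface (without boundary) with Gauss map $N:S\to\mathbb{S}^{n-1}$, strictly convex in the sense that the shape operator $\mathrm{d}N_p:T_pS\to T_pS$ is positive definite for every $p\in S$. Write $K(p)=\det \mathrm{d}N_p$ for the Gaussian curvature, $P_W$ for orthogonal projection onto a subspace $W$ of $\mathbb{R}^n$, and $|a\wedge b|=(|a|^2|b|^2-\langle a,b\rangle^2)^{1/2}$. For distinct $u,u'\in S$ let $R_uu'$ be the unique point $u''\in S$ with $u''\neq u'$, $$(u'-u'')\cdot N(u)=0\quad\text{and}\quad N(u)\wedge N(u')\wedge N(u'')=0,$$ whenever there is exactly one such point (otherwise $R_uu'$ is undefined). Assume that, at every pair $(u,u')$ of distinct points of $S$ for which $R_uu'$ is defined, the maps $p\mapsto R_pu'$ and $p\mapsto R_up$ on $S$ are defined near, and differentiable at, $u$ and $u'$ respectively. For such $(u,u')$ let $J(u,u')$ be the Jacobian (the absolute value of the determinant of the differential between tangent spaces, computed in orthonormal bases) of $p\mapsto R_pu'$ at $p=u$, and let $\Delta(u,u')$ be the Jacobian of $p\mapsto R_up$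 at $p=u'$. Then for all distinct $u,u'\in S$ for which $u''=R_uu'$ is defined, also $R_uu''$ is defined with $u''\ne u$ and $R_uu''=u'$, the numbers $|N(u)\wedge N(u')|$, $|N(u)\wedge N(u'')|$, $\langle P_{T_{u''}S}N(u),(\mathrm{d}N_{u''})^{-1}(P_{T_{u''}S}N(u))\rangle$ and $K(u'')$ are positive, and $$J(u,u')=\left(\frac{|N(u')\wedge N(u'')|}{|N(u)\wedge N(u')|}\right)^{n-2}\left|\frac{\langle u''-u',N(u'')\rangle}{\langle P_{T_{u''}S}N(u),(\mathrm{d}N_{u''})^{-1}(P_{T_{u''}S}N(u))\rangle}\right|\frac{K(u)}{K(u'')},$$ $$\Delta(u,u')=\left(\frac{|N(u)\wedge N(u'')|}{|N(u)\wedge N(u')|}\right)^{n-1}\frac{|\langle P_{T_{u'}S}N(u),(\mathrm{d}N_{u'})^{-1}(P_{T_{u'}S}N(u))\rangle|}{|\langle P_{T_{u''}S}N(u),(\mathrm{d}N_{u''})^{-1}(P_{T_{u''}S}N(u))\rangle|}\,\frac{K(u')}{K(u'')},$$ $$J(u,u')\,\Delta(u,u'')=J(u,u'').$$ Here $0^0=1$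 when $n=2$. -/

import Mathlib

open scoped ContDiff RealInnerProductSpace

noncomputable section

/-- `S ⊆ ℝⁿ` is a smooth embedded hypersurface (without boundary): near each of its points it is
the zero set of a smooth function with nonvanishing differential at that point. -/
def IsSmoothHypersurface {n : ℕ} (S : Set (EuclideanSpace ℝ (Fin n))) : Prop :=
  ∀ p ∈ S, ∃ U : Set (EuclideanSpace ℝ (Fin n)), IsOpen U ∧ p ∈ U ∧
    ∃ f : EuclideanSpace ℝ (Fin n) → ℝ, ContDiffOn ℝ ∞ f U ∧ fderiv ℝ f p ≠ 0 ∧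
      S ∩ U = {q ∈ U | f q = 0}

/-- The tangent space `T_p S`, as a linear subspace of `ℝⁿ`. -/
def tangentSpaceOf {n : ℕ} (S : Set (EuclideanSpace ℝ (Fin n))) (p : EuclideanSpace ℝ (Fin n)) :
    Submodule ℝ (EuclideanSpace ℝ (Fin n)) :=
  Submodule.span ℝ (tangentConeAt ℝ S p)

/-- `N` is (on `S`) a Gauss map of `S`: a continuous field of unit normals. Only the values of `N`
at points of `S` matter. -/
def IsGaussMap {n : ℕ} (S : Set (EuclideanSpace ℝ (Fin n)))
    (N : EuclideanSpace ℝ (Fin n) → EuclideanSpace ℝ (Fin n)) : Prop :=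
  ContinuousOn N S ∧ ∀ p ∈ S, ‖N p‖ = 1 ∧ ∀ v ∈ tangentSpaceOf S p, ⟪v, N p⟫ = 0

/-- The differential `dF_p : T_p S → ℝⁿ` of a map `F` on `S`. The derivative within `S` is only
determined along `T_p S`, to which it is restricted here. -/
def tangentialDeriv {n : ℕ} (S : Set (EuclideanSpace ℝ (Fin n)))
    (F : EuclideanSpace ℝ (Fin n) → EuclideanSpace ℝ (Fin n)) (p : EuclideanSpace ℝ (Fin n)) :
    tangentSpaceOf S p →ₗ[ℝ] EuclideanSpace ℝ (Fin n) :=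
  (fderivWithin ℝ F S p : EuclideanSpace ℝ (Fin n) →ₗ[ℝ] EuclideanSpace ℝ (Fin n)) ∘ₗ
    (tangentSpaceOf S p).subtype

/-- The Jacobian at `p` of a map `F` from `S` to a hypersurface, with respect to surface measure:
`√ det (dF_pᵀ dF_p)`, which is the absolute value of the determinant of
`dF_p : T_p S → T_{F p} S` in orthonormal bases. -/
def tangentialJacobian {n : ℕ} (S : Set (EuclideanSpace ℝ (Fin n)))
    (F : EuclideanSpace ℝ (Fin n) → EuclideanSpace ℝ (Fin n)) (p : EuclideanSpace ℝ (Fin n)) : ℝ :=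
  √ (LinearMap.det (LinearMap.adjoint (tangentialDeriv S F p) ∘ₗ tangentialDeriv S F p))

/-- The shape operator `dN_p : T_p S → T_p S`. As `N` takes values in the unit sphere, `dN_p`
already maps into `N(p)^⊥ = T_p S`, so the projection only changes the codomain. -/
def shapeOperator {n : ℕ} (S : Set (EuclideanSpace ℝ (Fin n)))
    (N : EuclideanSpace ℝ (Fin n) → EuclideanSpace ℝ (Fin n)) (p : EuclideanSpace ℝ (Fin n)) :
    Module.End ℝ (tangentSpaceOf S p) :=
  ((tangentSpaceOf S p).orthogonalProjectionOnto :
    EuclideanSpace ℝ (Fin n) →ₗ[ℝ] tangentSpaceOf S p) ∘ₗ tangentialDeriv S N p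

/-- The Gaussian curvature `K(p) = det dN_p`. -/
def gaussCurvature {n : ℕ} (S : Set (EuclideanSpace ℝ (Fin n)))
    (N : EuclideanSpace ℝ (Fin n) → EuclideanSpace ℝ (Fin n)) (p : EuclideanSpace ℝ (Fin n)) : ℝ :=
  LinearMap.det (shapeOperator S N p)

/-- The quantity `⟨P_{T_p S} a, (dN_p)⁻¹ (P_{T_p S} a)⟩`, where `P_{T_p S}` is the orthogonal
projection onto `T_p S`. -/
def invShapeForm {n : ℕ} (S : Set (EuclideanSpace ℝ (Fin n)))
    (N : EuclideanSpace ℝ (Fin n) → EuclideanSpace ℝ (Fin n))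
    (p a : EuclideanSpace ℝ (Fin n)) : ℝ :=
  ⟪(tangentSpaceOf S p).orthogonalProjectionOnto a,
    Ring.inverse (shapeOperator S N p) ((tangentSpaceOf S p).orthogonalProjectionOnto a)⟫

/-- The norm `|a ∧ b|` of the bivector `a ∧ b`. -/
def wedgeNorm {n : ℕ} (a b : EuclideanSpace ℝ (Fin n)) : ℝ :=
  √ (‖a‖ ^ 2 * ‖b‖ ^ 2 - ⟪a, b⟫ ^ 2)

/-- The conditions on `w` for being the third point of `u, u'`: it is a point of `S` other than
`u'` with `(u' - w) · N(u) = 0` and `N(u) ∧ N(u') ∧ N(w) = 0`. -/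
def ThirdPointConditions {n : ℕ} (S : Set (EuclideanSpace ℝ (Fin n)))
    (N : EuclideanSpace ℝ (Fin n) → EuclideanSpace ℝ (Fin n))
    (u u' w : EuclideanSpace ℝ (Fin n)) : Prop :=
  w ∈ S ∧ w ≠ u' ∧ ⟪u' - w, N u⟫ = 0 ∧ ¬ LinearIndependent ℝ ![N u, N u', N w]

/-- For distinct `u, u'`, the point `R_u u'` exists and equals `w`: `w` is the unique point of `S`
that satisfies the conditions above. -/
def IsThirdPoint {n : ℕ} (S : Set (EuclideanSpace ℝ (Fin n)))
    (N : EuclideanSpace ℝ (Fin n) → EuclideanSpace ℝ (Fin n))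
    (u u' w : EuclideanSpace ℝ (Fin n)) : Prop :=
  u ≠ u' ∧ ThirdPointConditions S N u u' w ∧ ∀ z, ThirdPointConditions S N u u' z → z = w

open scoped Classical in
/-- The point `R_u u'`. Where no third point exists (in particular for `u = u'`) the value is `u'`;
in particular `R_u u = u`. As a third point is never equal to `u'`, a map that is continuous
at a pair for which the third point exists has the third point existing at all nearby pairs. -/
def thirdPoint {n : ℕ} (S : Set (EuclideanSpace ℝ (Fin n)))
    (N : EuclideanSpace ℝ (Fin n) → EuclideanSpace ℝ (Fin n))
    (u u' : EuclideanSpace ℝ (Fin n)) : EuclideanSpace ℝ (Fin n) :=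
  if h : ∃ w, IsThirdPoint S N u u' w then h.choose else u'

theorem IsThirdPoint.thirdPoint_eq {n : ℕ} {S : Set (EuclideanSpace ℝ (Fin n))}
    {N : EuclideanSpace ℝ (Fin n) → EuclideanSpace ℝ (Fin n)}
    {u u' w : EuclideanSpace ℝ (Fin n)} (h : IsThirdPoint S N u u' w) :
    thirdPoint S N u u' = w := by
  have h' : ∃ w, IsThirdPoint S N u u' w := ⟨w, h⟩
  rw [thirdPoint, dif_pos h']
  exact h.2.2 _ h'.choose_spec.2.1

theorem thirdPoint_self {n : ℕ} (S : Set (EuclideanSpace ℝ (Fin n)))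
    (N : EuclideanSpace ℝ (Fin n) → EuclideanSpace ℝ (Fin n)) (u : EuclideanSpace ℝ (Fin n)) :
    thirdPoint S N u u = u := by
  rw [thirdPoint, dif_neg]
  rintro ⟨w, h, _⟩
  exact h rfl

/-- `J(u, u')`: the Jacobian at `u` of the map `p ↦ R_p u'` on `S`. -/
def jacobianJ {n : ℕ} (S : Set (EuclideanSpace ℝ (Fin n)))
    (N : EuclideanSpace ℝ (Fin n) → EuclideanSpace ℝ (Fin n))
    (u u' : EuclideanSpace ℝ (Fin n)) : ℝ :=
  tangentialJacobian S (fun p => thirdPoint S N p u') u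

/-- `Δ(u, u')`: the Jacobian at `u'` of the map `p ↦ R_u p` on `S`. -/
def jacobianDelta {n : ℕ} (S : Set (EuclideanSpace ℝ (Fin n)))
    (N : EuclideanSpace ℝ (Fin n) → EuclideanSpace ℝ (Fin n))
    (u u' : EuclideanSpace ℝ (Fin n)) : ℝ :=
  tangentialJacobian S (fun p => thirdPoint S N u p) u'

end

/-! ### Determinants of prescribed endomorphisms -/

section LinearAlgebra

open Module

variable {V : Type*} [NormedAddCommGroup V] [InnerProductSpace ℝ V]

/-! Write N, N', N'' for the normals at u, u', u''. If N and N' are not parallel, coplanarity reads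
N'' = αN + βN', with |α| = |N' ∧ N''| / |N ∧ N'| and |β| = |N ∧ N''| / |N ∧ N'|. Let G be one of the
two maps and p its variable point. Differentiating coplanarity and testing against x orthogonal to
the plane of the normals gives ⟨dN(dG v), x⟩ = γ⟨dN v, x⟩, where γ = α if u varies and γ = β if u'
varies (`inner_fderivWithin_of_mem_span`): the derivatives of the coefficients drop out. These are n
- 2 scalar equations on dG. The last one comes from the height condition: ⟨dG v, N⟩ is ⟨u' - u'', dN
v⟩ if u varies and ⟨v, N⟩ if u' varies. A reflection identifies the two tangent spaces, fixing the
directions orthogonal to the plane, and `det_mul_of_prescribed` reads off the determinant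
(`tangentialJacobian_mul`). The third identity follows by applying the formulas at (u, u') and (u,
u'') and comparing the components of u'' - u' along N' and N''.

What remains is that N is parallel to neither N' nor N''. If N ∥ N', strict convexity gives pairs x
≠ y arbitrarily close to u', at equal height over the tangent space and with normals coplanar with
N'; then R_u x, if defined, is y, which contradicts continuity of R_u at u', as R_u u' ≠ u'
(`IsThirdPoint.inner_sq_ne_one_left`). If N ∥ N'', then dR_u maps into N^⊥ while preserving heights
along N, so the tangent space at u' lies in N^⊥ and N ∥ N' after all. -/

/-- The endomorphism that is `γ` on `τᗮ` modulo `τ`, with `τ`-component `φ`. -/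
noncomputable def scaleReplace (τ : V) (γ : ℝ) (φ : V →ₗ[ℝ] ℝ) : End ℝ V :=
  γ • LinearMap.id + (φ - γ • (innerSL ℝ τ : V →ₗ[ℝ] ℝ)).smulRight τ

theorem scaleReplace_apply (τ : V) (γ : ℝ) (φ : V →ₗ[ℝ] ℝ) (y : V) :
    scaleReplace τ γ φ y = γ • (y - ⟪τ, y⟫ • τ) + φ y • τ := by
  simp [scaleReplace, sub_smul, smul_sub, mul_smul]
  abel

variable [FiniteDimensional ℝ V]

/-- For γ ≠ 0 this is γ times a rank-one perturbation of the identity. For γ = 0 the rank is at most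
one, so the determinant vanishes except in dimension one, where `0 ^ 0 = 1`; that is the case n = 2
of the theorem. -/
theorem det_scaleReplace {τ : V} (hτ : ‖τ‖ = 1) (γ : ℝ) (φ : V →ₗ[ℝ] ℝ) :
    LinearMap.det (scaleReplace τ γ φ) = γ ^ (finrank ℝ V - 1) * φ τ := by
  have hττ : ⟪τ, τ⟫ = 1 := by rw [real_inner_self_eq_norm_sq, hτ]; norm_num
  have hτ0 : τ ≠ 0 := by rintro rfl; simp at hτ
  have : Nontrivial V := ⟨τ, 0, hτ0⟩
  have hpos : 0 < finrank ℝ V := finrank_pos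
  have key : ∀ f : V →ₗ[ℝ] ℝ,
      LinearMap.det (LinearMap.id + f.smulRight τ) = 1 + f τ := by
    intro f
    rw [← LinearMap.transvection.det f τ]
    congr 1
  rcases eq_or_ne γ 0 with rfl | hγ
  · rcases Nat.lt_or_ge 1 (finrank ℝ V) with h1 | h1
    · rw [zero_pow (by omega), zero_mul]
      by_contra hdet
      have hinj : Function.Injective (scaleReplace τ 0 φ) :=
        (LinearMap.equivOfDetNeZero _ hdet).injective
      have hker : LinearMap.ker φ ≠ ⊥ := by
        intro h
        have := LinearMap.finrank_range_add_finrank_ker φ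
        rw [h, finrank_bot] at this
        have h2 := Submodule.finrank_le (LinearMap.range φ)
        rw [finrank_self] at h2
        omega
      obtain ⟨y, hy, hy0⟩ := Submodule.exists_mem_ne_zero_of_ne_bot hker
      apply hy0
      apply hinj
      rw [LinearMap.mem_ker] at hy
      simp [scaleReplace_apply, hy]
    · have hd : finrank ℝ V = 1 := by omega
      have : scaleReplace τ 0 φ =
          LinearMap.id + (φ - (innerSL ℝ τ : V →ₗ[ℝ] ℝ)).smulRight τ := by
        ext y
        obtain ⟨c, rfl⟩ := (finrank_eq_one_iff_of_nonzero' τ hτ0).1 hd y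
        simp [scaleReplace, sub_smul, hτ]
      rw [this, key, hd]
      simp [hτ]
  · have : scaleReplace τ γ φ = γ • (LinearMap.id +
        (γ⁻¹ • φ - (innerSL ℝ τ : V →ₗ[ℝ] ℝ)).smulRight τ) := by
      ext y
      simp [scaleReplace, sub_smul, smul_sub, smul_smul]
      field_simp
    rw [this, LinearMap.det_smul, key]
    obtain ⟨k, hk⟩ : ∃ k, finrank ℝ V = k + 1 := ⟨finrank ℝ V - 1, by omega⟩
    simp [hτ, hk, pow_succ]
    field_simp

/-- A linear map pinned down modulo `τ` by `h₁`, and in one further direction by `h₂`, has the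
determinant that these equations suggest. -/
theorem det_mul_of_prescribed {τ : V} (hτ : ‖τ‖ = 1) {γ : ℝ} {A₁ A₂ A₂' D : End ℝ V}
    {φ ψ : V →ₗ[ℝ] ℝ} (hA : A₂' ∘ₗ A₂ = LinearMap.id)
    (h₁ : ∀ v x, ⟪τ, x⟫ = 0 → ⟪A₂ (D v), x⟫ = γ * ⟪A₁ v, x⟫)
    (h₂ : ∀ v, ψ (D v) = φ (A₁ v)) :
    ψ (A₂' τ) * LinearMap.det A₂ * LinearMap.det D =
      γ ^ (finrank ℝ V - 1) * φ τ * LinearMap.det A₁ := by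
  have hττ : ⟪τ, τ⟫ = 1 := by rw [real_inner_self_eq_norm_sq, hτ]; norm_num
  -- The components orthogonal to τ agree by `h₁`, those along τ by `h₂`, since `A₂'` undoes `A₂`.
  have hcomp : scaleReplace τ 1 (ψ ∘ₗ A₂') ∘ₗ A₂ ∘ₗ D = scaleReplace τ γ φ ∘ₗ A₁ := by
    ext v
    have hA' : A₂' (A₂ (D v)) = D v := LinearMap.congr_fun hA (D v)
    simp only [LinearMap.comp_apply, scaleReplace_apply, hA', h₂, one_smul]
    congr 1
    refine ext_inner_right ℝ fun x => ?_
    have hx : ⟪τ, x - ⟪τ, x⟫ • τ⟫ = 0 := by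
      rw [inner_sub_right, inner_smul_right, hττ]; ring
    have := h₁ v _ hx
    simp only [inner_sub_right, inner_smul_right, inner_sub_left, inner_smul_left] at this ⊢
    rw [real_inner_comm τ (A₂ _), real_inner_comm τ (A₁ _)] at this
    simp only [conj_trivial]
    linarith
  have := congrArg LinearMap.det hcomp
  rw [LinearMap.det_comp, LinearMap.det_comp, LinearMap.det_comp, det_scaleReplace hτ,
    det_scaleReplace hτ] at this
  simpa [mul_assoc] using this

/-- Symmetry of A is not needed: the maps on the segment from the identity to A are all injective,
so the determinant keeps its sign along it. -/
theorem det_pos_of_inner_pos {A : End ℝ V} (hA : ∀ v, v ≠ 0 → 0 < ⟪v, A v⟫) :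
    0 < LinearMap.det A := by
  let B : ℝ → End ℝ V := fun t => (1 - t) • LinearMap.id + t • A
  have hne : ∀ t ∈ Set.Icc (0 : ℝ) 1, LinearMap.det (B t) ≠ 0 := by
    intro t ht h0
    obtain ⟨v, hv, hv0⟩ := Submodule.exists_mem_ne_zero_of_ne_bot
      (LinearMap.bot_lt_ker_of_det_eq_zero h0).ne'
    have hv' : (1 - t) * ⟪v, v⟫ + t * ⟪v, A v⟫ = 0 := by
      have : ⟪v, B t v⟫ = 0 := by rw [LinearMap.mem_ker.1 hv, inner_zero_right]
      simpa [B, inner_add_right, inner_smul_right] using this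
    have h1 := hA v hv0
    have h2 : 0 < ⟪v, v⟫ := real_inner_self_pos.2 hv0
    rcases eq_or_lt_of_le ht.1 with h | h
    · subst h; linarith
    · nlinarith [mul_pos h h1, mul_nonneg (sub_nonneg.2 ht.2) h2.le]
  have hcont : Continuous fun t => LinearMap.det (B t) := by
    let b := Module.finBasis ℝ V
    have : (fun t => LinearMap.det (B t)) =
        fun t => ((1 - t) • (1 : Matrix _ _ ℝ) + t • LinearMap.toMatrix b b A).det := by
      ext t
      rw [← LinearMap.det_toMatrix b]
      simp [B]
    rw [this]
    fun_prop
  by_contra! hle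
  have h0 : LinearMap.det (B 0) = 1 := by simp [B]
  have h1 : LinearMap.det (B 1) = LinearMap.det A := by simp [B]
  obtain ⟨t, ht, h⟩ := intermediate_value_Icc' zero_le_one hcont.continuousOn
    (show (0 : ℝ) ∈ Set.Icc (LinearMap.det (B 1)) (LinearMap.det (B 0)) by
      rw [h0, h1]; exact ⟨hle, zero_le_one⟩)
  exact hne t ht h

theorem sqrt_det_adjoint_comp_self {W : Type*} [NormedAddCommGroup W] [InnerProductSpace ℝ W]
    [FiniteDimensional ℝ W] (D : V →ₗ[ℝ] W) (j : V →ₗᵢ[ℝ] W) (B : End ℝ V)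
    (h : ∀ v, D v = j (B v)) :
    √(LinearMap.det (LinearMap.adjoint D ∘ₗ D)) = |LinearMap.det B| := by
  have hD : LinearMap.adjoint D ∘ₗ D = LinearMap.adjoint B ∘ₗ B := by
    ext v
    refine ext_inner_right ℝ fun x => ?_
    simp [LinearMap.adjoint_inner_left, h]
  let b := stdOrthonormalBasis ℝ V
  have hadj : LinearMap.det (LinearMap.adjoint B) = LinearMap.det B := by
    rw [← LinearMap.det_toMatrix b.toBasis, ← LinearMap.det_toMatrix b.toBasis,
      LinearMap.toMatrix_adjoint, Matrix.det_conjTranspose]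
    simp
  rw [hD, LinearMap.det_comp, hadj, Real.sqrt_mul_self_eq_abs]

end LinearAlgebra

/-! ### Tangent spaces and the differential of the Gauss map -/

section Tangent

open Module Filter Topology

variable {n : ℕ} {S : Set (EuclideanSpace ℝ (Fin n))}
  {N : EuclideanSpace ℝ (Fin n) → EuclideanSpace ℝ (Fin n)} {p : EuclideanSpace ℝ (Fin n)}

theorem mem_tangentConeAt_of_hasDerivAt {γ : ℝ → EuclideanSpace ℝ (Fin n)} {t : ℝ}
    {v : EuclideanSpace ℝ (Fin n)} (hγ : HasDerivAt γ v t) (hS : ∀ᶠ s in 𝓝 t, γ s ∈ S) :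
    v ∈ tangentConeAt ℝ S (γ t) := by
  have h := (hγ.hasFDerivAt.hasFDerivWithinAt (s := γ ⁻¹' S)).mapsTo_tangent_cone
  rw [tangentConeAt_of_mem_nhds (s := γ ⁻¹' S) hS] at h
  have h1 := h (Set.mem_univ (1 : ℝ))
  simp only [ContinuousLinearMap.toSpanSingleton_apply, one_smul] at h1
  exact tangentConeAt_mono (Set.image_preimage_subset γ S) h1

/-- A derivative within S is determined only on the tangent cone, hence on its span. Every identity
along S is differentiated by means of this lemma. -/
theorem HasFDerivWithinAt.eqOn_tangentSpaceOf {F : Type*} [NormedAddCommGroup F]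
    [NormedSpace ℝ F] {f g : EuclideanSpace ℝ (Fin n) → F}
    {f' g' : EuclideanSpace ℝ (Fin n) →L[ℝ] F} (hf : HasFDerivWithinAt f f' S p)
    (hg : HasFDerivWithinAt g g' S p) (hp : p ∈ S) (hfg : f =ᶠ[𝓝[S] p] g)
    {v : EuclideanSpace ℝ (Fin n)} (hv : v ∈ tangentSpaceOf S p) : f' v = g' v := by
  have h : Set.EqOn f' g' (tangentConeAt ℝ S p) :=
    hf.unique_on (hg.congr_of_eventuallyEq hfg (hfg.self_of_nhdsWithin hp))
  exact LinearMap.eqOn_span (f := (f' : _ →ₗ[ℝ] F)) (g := (g' : _ →ₗ[ℝ] F)) h hv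

theorem HasFDerivWithinAt.mapsTo_tangentSpaceOf
    {F : EuclideanSpace ℝ (Fin n) → EuclideanSpace ℝ (Fin n)}
    {F' : EuclideanSpace ℝ (Fin n) →L[ℝ] EuclideanSpace ℝ (Fin n)}
    (hF : HasFDerivWithinAt F F' S p) (hS : Set.MapsTo F S S)
    {v : EuclideanSpace ℝ (Fin n)} (hv : v ∈ tangentSpaceOf S p) :
    F' v ∈ tangentSpaceOf S (F p) := by
  have h : tangentSpaceOf S p ≤
      (tangentSpaceOf S (F p)).comap (F' : _ →ₗ[ℝ] EuclideanSpace ℝ (Fin n)) := by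
    refine Submodule.span_le.2 fun w hw => Submodule.subset_span ?_
    exact tangentConeAt_mono hS.image_subset (hF.mapsTo_tangent_cone hw)
  exact h hv

theorem HasFDerivWithinAt.comp_curve {F : Type*} [NormedAddCommGroup F]
    [NormedSpace ℝ F] {f : EuclideanSpace ℝ (Fin n) → F}
    {f' : EuclideanSpace ℝ (Fin n) →L[ℝ] F} {γ : ℝ → EuclideanSpace ℝ (Fin n)} {t : ℝ}
    {v : EuclideanSpace ℝ (Fin n)} (hf : HasFDerivWithinAt f f' S (γ t)) (hγ : HasDerivAt γ v t)
    (hS : ∀ᶠ s in 𝓝 t, γ s ∈ S) : HasDerivAt (fun s => f (γ s)) (f' v) t := by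
  have h := hf.comp_hasDerivWithinAt (s := γ ⁻¹' S) t hγ.hasDerivWithinAt (fun _ h => h)
  exact h.hasDerivAt hS

/-- The implicit function theorem gives a curve in the zero set with velocity v. -/
theorem ker_fderiv_subset_tangentConeAt {f : EuclideanSpace ℝ (Fin n) → ℝ}
    (hf : ContDiffAt ℝ ∞ f p) (h0 : f p = 0) (hf' : fderiv ℝ f p ≠ 0)
    (hS : ∀ᶠ q in 𝓝 p, f q = 0 → q ∈ S) {v : EuclideanSpace ℝ (Fin n)}
    (hv : fderiv ℝ f p v = 0) : v ∈ tangentConeAt ℝ S p := by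
  have hst : HasStrictFDerivAt f (fderiv ℝ f p) p := hf.hasStrictFDerivAt (by simp)
  have hr : (fderiv ℝ f p).range = ⊤ := by
    apply LinearMap.range_eq_top.2
    apply LinearMap.surjective
    intro h
    exact hf' (ContinuousLinearMap.coe_injective h)
  let k : (fderiv ℝ f p).ker := ⟨v, hv⟩
  let γ : ℝ → EuclideanSpace ℝ (Fin n) := fun t => hst.implicitFunction f _ hr (f p) (t • k)
  have hk : HasDerivAt (fun t : ℝ => t • k) k 0 := by
    simpa using (hasDerivAt_id (0 : ℝ)).smul_const k
  have hγ : HasDerivAt γ v 0 := by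
    have h1 : HasFDerivAt (hst.implicitFunction f _ hr (f p))
        (fderiv ℝ f p).ker.subtypeL ((0 : ℝ) • k) := by
      rw [zero_smul]; exact (hst.to_implicitFunction hr).hasFDerivAt
    exact h1.comp_hasDerivAt (0 : ℝ) hk
  have hγ0 : γ 0 = p := by simp [γ]
  have hev : ∀ᶠ t in 𝓝 (0 : ℝ), γ t ∈ S := by
    have h2 : Tendsto (fun t : ℝ => (f p, t • k)) (𝓝 0) (𝓝 (f p, 0)) := by
      refine tendsto_const_nhds.prodMk_nhds ?_
      simpa using hk.continuousAt.tendsto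
    have h3 : Tendsto γ (𝓝 0) (𝓝 p) := by simpa [hγ0] using hγ.continuousAt.tendsto
    filter_upwards [h2.eventually (hst.map_implicitFunction_eq hr), h3.eventually hS] with t h4 h5
    exact h5 (h4.trans h0)
  simpa [hγ0] using mem_tangentConeAt_of_hasDerivAt hγ hev

/-- Near a point, a smooth hypersurface is the zero set of a smooth function whose gradient is
everywhere a nonzero multiple of the normal. -/
theorem IsSmoothHypersurface.exists_defining (hS : IsSmoothHypersurface S) (hN : IsGaussMap S N)
    (hp : p ∈ S) : ∃ f : EuclideanSpace ℝ (Fin n) → ℝ, ContDiffAt ℝ ∞ f p ∧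
      (∀ᶠ q in 𝓝 p, q ∈ S ↔ f q = 0) ∧
      ∀ᶠ q in 𝓝 p, q ∈ S → tangentSpaceOf S q = (ℝ ∙ N q)ᗮ ∧
        ∃ c : ℝ, c ≠ 0 ∧ gradient f q = c • N q := by
  obtain ⟨U, hU, hpU, f, hf, hfp, hSU⟩ := hS p hp
  have hmem : ∀ q ∈ U, q ∈ S ↔ f q = 0 := by
    intro q hq
    have : q ∈ S ∩ U ↔ q ∈ {q ∈ U | f q = 0} := by rw [hSU]
    simpa [hq] using this
  refine ⟨f, hf.contDiffAt (hU.mem_nhds hpU), ?_, ?_⟩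
  · filter_upwards [hU.mem_nhds hpU] with q hq using hmem q hq
  · have hcont : ContinuousAt (fderiv ℝ f) p :=
      ((hf.contDiffAt (hU.mem_nhds hpU)).fderiv_right (m := 0) (by simp)).continuousAt
    filter_upwards [hU.mem_nhds hpU, hcont.eventually_ne hfp] with q hq hfq hqS
    have hle : ((ℝ ∙ gradient f q)ᗮ : Submodule ℝ (EuclideanSpace ℝ (Fin n))) ≤
        tangentSpaceOf S q := by
      intro v hv
      refine Submodule.subset_span (ker_fderiv_subset_tangentConeAt
        (hf.contDiffAt (hU.mem_nhds hq)) ((hmem q hq).1 hqS) hfq ?_ ?_)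
      · filter_upwards [hU.mem_nhds hq] with x hx using (hmem x hx).2
      · rw [Submodule.mem_orthogonal_singleton_iff_inner_right] at hv
        simpa [gradient] using hv
    have hle' : tangentSpaceOf S q ≤ (ℝ ∙ N q)ᗮ := fun v hv => by
      rw [Submodule.mem_orthogonal_singleton_iff_inner_left]
      exact (hN.2 q hqS).2 v hv
    have hNq : N q ≠ 0 := by
      intro h
      have := (hN.2 q hqS).1
      simp [h] at this
    have hg : gradient f q ≠ 0 := by
      simpa [gradient] using hfq
    -- Orthogonal complements of (∇f)^⊥ ≤ T_q S ≤ N^⊥.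
    have hspan : (ℝ ∙ N q) ≤ (ℝ ∙ gradient f q) := by
      have := Submodule.orthogonal_le (hle.trans hle')
      rwa [Submodule.orthogonal_orthogonal, Submodule.orthogonal_orthogonal] at this
    obtain ⟨c, hc⟩ := Submodule.mem_span_singleton.1
      (hspan (Submodule.mem_span_singleton_self (N q)))
    have hc0 : c ≠ 0 := by rintro rfl; simp at hc; exact hNq hc.symm
    have hgc : gradient f q = c⁻¹ • N q := by rw [← hc, smul_smul, inv_mul_cancel₀ hc0, one_smul]
    refine ⟨le_antisymm hle' ?_, c⁻¹, inv_ne_zero hc0, hgc⟩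
    rwa [hgc, Submodule.span_singleton_smul_eq (inv_ne_zero hc0).isUnit] at hle

theorem tangentSpaceOf_eq (hS : IsSmoothHypersurface S) (hN : IsGaussMap S N) (hp : p ∈ S) :
    tangentSpaceOf S p = (ℝ ∙ N p)ᗮ := by
  obtain ⟨f, -, -, h⟩ := hS.exists_defining hN hp
  exact (h.self_of_nhds hp).1

theorem mem_tangentSpaceOf_iff (hS : IsSmoothHypersurface S) (hN : IsGaussMap S N) (hp : p ∈ S)
    {v : EuclideanSpace ℝ (Fin n)} : v ∈ tangentSpaceOf S p ↔ ⟪N p, v⟫ = 0 := by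
  rw [tangentSpaceOf_eq hS hN hp, Submodule.mem_orthogonal_singleton_iff_inner_right]

theorem IsGaussMap.ne_zero (hN : IsGaussMap S N) (hp : p ∈ S) : N p ≠ 0 := by
  intro h
  have := (hN.2 p hp).1
  simp [h] at this

theorem IsGaussMap.inner_self (hN : IsGaussMap S N) (hp : p ∈ S) : ⟪N p, N p⟫ = 1 := by
  rw [real_inner_self_eq_norm_sq, (hN.2 p hp).1]; norm_num

theorem finrank_tangentSpaceOf (hS : IsSmoothHypersurface S) (hN : IsGaussMap S N) (hp : p ∈ S) :
    finrank ℝ (tangentSpaceOf S p) = n - 1 := by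
  have h := Submodule.finrank_add_finrank_orthogonal (ℝ ∙ N p)
  rw [← tangentSpaceOf_eq hS hN hp, finrank_span_singleton (hN.ne_zero hp),
    finrank_euclideanSpace_fin] at h
  omega

/-- If N were not differentiable, `fderivWithin` would be zero and so would the shape operator,
contrary to positivity on a nonzero tangent vector, which exists as n ≥ 2. -/
theorem differentiableWithinAt_gaussMap (hn : 2 ≤ n) (hS : IsSmoothHypersurface S)
    (hN : IsGaussMap S N) (hp : p ∈ S)
    (hconv : ∀ v : tangentSpaceOf S p, v ≠ 0 → 0 < ⟪v, shapeOperator S N p v⟫) :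
    DifferentiableWithinAt ℝ N S p := by
  by_contra hd
  have : Nontrivial (tangentSpaceOf S p) := by
    apply Module.nontrivial_of_finrank_pos (R := ℝ)
    rw [finrank_tangentSpaceOf hS hN hp]; omega
  obtain ⟨v, hv⟩ := exists_ne (0 : tangentSpaceOf S p)
  have := hconv v hv
  simp [shapeOperator, tangentialDeriv, fderivWithin_zero_of_not_differentiableWithinAt hd] at this

/-- Differentiate |N|² = 1. -/
theorem fderivWithin_gaussMap_mem (hS : IsSmoothHypersurface S) (hN : IsGaussMap S N) (hp : p ∈ S)
    (hd : DifferentiableWithinAt ℝ N S p) {v : EuclideanSpace ℝ (Fin n)}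
    (hv : v ∈ tangentSpaceOf S p) : fderivWithin ℝ N S p v ∈ tangentSpaceOf S p := by
  rw [mem_tangentSpaceOf_iff hS hN hp]
  have h1 := hd.hasFDerivWithinAt.inner ℝ hd.hasFDerivWithinAt
  have h2 := h1.eqOn_tangentSpaceOf (hasFDerivWithinAt_const (1 : ℝ) p S) hp
    (eventually_nhdsWithin_of_forall fun q hq => hN.inner_self hq) hv
  simp [fderivInnerCLM_apply, real_inner_comm] at h2
  linarith

theorem coe_shapeOperator (hS : IsSmoothHypersurface S) (hN : IsGaussMap S N) (hp : p ∈ S)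
    (hd : DifferentiableWithinAt ℝ N S p) (v : tangentSpaceOf S p) :
    (shapeOperator S N p v : EuclideanSpace ℝ (Fin n)) = fderivWithin ℝ N S p v := by
  have := Submodule.orthogonalProjectionOnto_mem_subspace_eq_self (K := tangentSpaceOf S p)
    ⟨_, fderivWithin_gaussMap_mem hS hN hp hd v.2⟩
  simpa [shapeOperator, tangentialDeriv] using congrArg Subtype.val this

end Tangent

/-! ### Nearby points of equal height with coplanar normals -/

section Curve

open Module Filter Topology

variable {n : ℕ} {S : Set (EuclideanSpace ℝ (Fin n))}
  {N : EuclideanSpace ℝ (Fin n) → EuclideanSpace ℝ (Fin n)} {p : EuclideanSpace ℝ (Fin n)}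

/-- Where the shape operator is positive definite, the preimage under the Gauss map of a great
circle through `N p` contains a regular curve through `p`. -/
theorem exists_curve_gaussMap_mem_span (hS : IsSmoothHypersurface S) (hN : IsGaussMap S N)
    (hp : p ∈ S) (hd : DifferentiableWithinAt ℝ N S p)
    (hconv : ∀ v : tangentSpaceOf S p, v ≠ 0 → 0 < ⟪v, shapeOperator S N p v⟫)
    {v : EuclideanSpace ℝ (Fin n)} (hvp : ⟪N p, v⟫ = 0) :
    ∃ (γ : ℝ → EuclideanSpace ℝ (Fin n)) (Ψ : EuclideanSpace ℝ (Fin n) → EuclideanSpace ℝ (Fin n)),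
      ContDiffAt ℝ ∞ γ 0 ∧ γ 0 = p ∧ (∀ᶠ t in 𝓝 0, γ t ∈ S) ∧ (∀ᶠ t in 𝓝 0, Ψ (γ t) = t • v) ∧
      DifferentiableAt ℝ Ψ p ∧ ∀ᶠ t in 𝓝 0, N (γ t) ∈ Submodule.span ℝ {N p, v} := by
  obtain ⟨f, hf, hfS, hfN⟩ := hS.exists_defining hN hp
  set e := N p with he
  have hee : ⟪e, e⟫ = 1 := hN.inner_self hp
  have hg : ContDiffAt ℝ ∞ (gradient f) p := by
    have h1 : ContDiffAt ℝ ∞ (fderiv ℝ f) p := hf.fderiv_right (by simp)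
    exact (InnerProductSpace.toDual ℝ
      (EuclideanSpace ℝ (Fin n))).symm.toContinuousLinearEquiv.contDiff.contDiffAt.comp p h1
  obtain ⟨-, c, hc, hgp⟩ := hfN.self_of_nhds hp
  have hfp : f p = 0 := hfS.self_of_nhds.1 hp
  -- As v ⊥ e, the equation Ψ x = t • v says that f x = 0 and that the part of ∇f x orthogonal to e
  -- is t • v. So the inverse image of the line under Ψ is the desired curve.
  let Ψ : EuclideanSpace ℝ (Fin n) → EuclideanSpace ℝ (Fin n) :=
    fun x => gradient f x - ⟪e, gradient f x⟫ • e + f x • e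
  have hΨ : ContDiffAt ℝ ∞ Ψ p :=
    (hg.sub ((contDiffAt_const.inner ℝ hg).smul contDiffAt_const)).add (hf.smul contDiffAt_const)
  have hΨp : Ψ p = 0 := by
    simp only [Ψ, hfp, hgp, inner_smul_right, ← he, hee]
    simp
  set H := fderiv ℝ (gradient f) p with hH
  have hgd : HasFDerivAt (gradient f) H p := (hg.differentiableAt (by simp)).hasFDerivAt
  have hfd : HasFDerivAt f (fderiv ℝ f p) p := (hf.differentiableAt (by simp)).hasFDerivAt
  let L := fderiv ℝ Ψ p
  have hL : ∀ z, L z = H z - ⟪e, H z⟫ • e + fderiv ℝ f p z • e := by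
    intro z
    have h1 := (hgd.sub (((hasFDerivAt_const e p).inner ℝ hgd).smul_const e)).add
      (hfd.smul_const e)
    have h2 : fderiv ℝ Ψ p = _ := h1.fderiv
    simp only [L, h2]
    simp [fderivInnerCLM_apply]
  have hfdz : ∀ z, fderiv ℝ f p z = c * ⟪e, z⟫ := by
    intro z
    have : ⟪gradient f p, z⟫ = fderiv ℝ f p z := by simp [gradient]
    rw [← this, hgp, inner_smul_left]; simp [he]
  -- For z in the kernel, the e-component shows that z is tangent, and pairing with z gives ⟪H z, z⟫
  -- = 0. Since ∇f is parallel to N along S, ⟪H z, z⟫ = c ⟪dN z, z⟫, so z = 0 by convexity.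
  have hLinj : Function.Injective (L : EuclideanSpace ℝ (Fin n) →ₗ[ℝ] EuclideanSpace ℝ (Fin n)) := by
    rw [← LinearMap.ker_eq_bot, LinearMap.ker_eq_bot']
    intro z hz
    have hz' : L z = 0 := hz
    rw [hL] at hz'
    have hez : ⟪e, z⟫ = 0 := by
      have := congrArg (fun w => ⟪e, w⟫) hz'
      simp only [inner_add_right, inner_sub_right, inner_smul_right, hee, hfdz,
        inner_zero_right] at this
      have h3 : c * ⟪e, z⟫ = 0 := by linarith
      exact (mul_eq_zero.1 h3).resolve_left hc
    have hzT : z ∈ tangentSpaceOf S p := (mem_tangentSpaceOf_iff hS hN hp).2 hez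
    -- the gradient is parallel to the normal along `S`
    have hpar : (fun q => ⟪N q, z⟫ * ⟪gradient f q, e⟫) =ᶠ[𝓝[S] p]
        fun q => ⟪gradient f q, z⟫ * ⟪N q, e⟫ := by
      filter_upwards [nhdsWithin_le_nhds hfN, self_mem_nhdsWithin] with q hq hqS
      obtain ⟨-, k, -, hk⟩ := hq hqS
      simp only [hk, inner_smul_left]
      ring
    have hcz := hasFDerivWithinAt_const (𝕜 := ℝ) z p S
    have hce := hasFDerivWithinAt_const (𝕜 := ℝ) e p S
    have hNd := hd.hasFDerivWithinAt
    have hgw := hgd.hasFDerivWithinAt (s := S)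
    have h4 := ((hNd.inner ℝ hcz).mul (hgw.inner ℝ hce)).eqOn_tangentSpaceOf
      ((hgw.inner ℝ hcz).mul (hNd.inner ℝ hce)) hp hpar hzT
    have hHz : ⟪H z, z⟫ = 0 := by
      have := congrArg (fun w => ⟪w, z⟫) hz'
      simpa [inner_add_left, inner_sub_left, inner_smul_left, hez] using this
    simp [fderivInnerCLM_apply, ← he, hez, hgp, inner_smul_left, hHz, hc] at h4
    by_contra hz0
    have h5 := hconv ⟨z, hzT⟩ (by simpa using hz0)
    rw [Submodule.coe_inner, coe_shapeOperator hS hN hp hd] at h5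
    rw [real_inner_comm] at h5
    exact h5.ne' (h4.resolve_left (hN.ne_zero hp))
  let L' : EuclideanSpace ℝ (Fin n) ≃L[ℝ] EuclideanSpace ℝ (Fin n) :=
    (LinearEquiv.ofInjectiveEndo _ hLinj).toContinuousLinearEquiv
  have hΨ' : HasFDerivAt Ψ (L' : _ →L[ℝ] EuclideanSpace ℝ (Fin n)) p := by
    have h1 : HasFDerivAt Ψ L p := (hΨ.differentiableAt (by simp)).hasFDerivAt
    convert! h1
  have hinf : (∞ : WithTop ℕ∞) ≠ 0 := by simp
  let Φ := hΨ.localInverse hΨ' hinf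
  have hΦ : ContDiffAt ℝ ∞ Φ (Ψ p) := hΨ.to_localInverse hΨ' hinf
  have hΦ0 : Φ (Ψ p) = p := hΨ.localInverse_apply_image hΨ' hinf
  rw [hΨp] at hΦ hΦ0
  have hright : ∀ᶠ y in 𝓝 (0 : EuclideanSpace ℝ (Fin n)), Ψ (Φ y) = y := by
    have := (hΨ.hasStrictFDerivAt' hΨ' hinf).eventually_right_inverse
    rwa [hΨp] at this
  have hline : Tendsto (fun t : ℝ => t • v) (𝓝 0) (𝓝 0) := by
    have : Continuous fun t : ℝ => t • v := by fun_prop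
    simpa using this.tendsto 0
  have hγc : ContDiffAt ℝ ∞ (fun t : ℝ => Φ (t • v)) 0 := by
    have h1 : ContDiffAt ℝ ∞ Φ ((0 : ℝ) • v) := by rwa [zero_smul]
    exact h1.comp (0 : ℝ) (contDiffAt_fun_id.smul contDiffAt_const)
  have hγt : Tendsto (fun t : ℝ => Φ (t • v)) (𝓝 0) (𝓝 p) := by
    simpa [hΦ0] using hγc.continuousAt.tendsto
  have hΨγ : ∀ᶠ t in 𝓝 (0 : ℝ), Ψ (Φ (t • v)) = t • v := hline.eventually hright
  have hγS : ∀ᶠ t in 𝓝 (0 : ℝ), Φ (t • v) ∈ S := by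
    filter_upwards [hΨγ, hγt.eventually hfS] with t h1 h2
    rw [h2]
    have := congrArg (fun w => ⟪e, w⟫) h1
    simp only [Ψ, inner_add_right, inner_sub_right, inner_smul_right, hee, hvp] at this
    linarith
  refine ⟨fun t => Φ (t • v), Ψ, hγc, by simp [hΦ0], hγS, hΨγ, hΨ'.differentiableAt, ?_⟩
  filter_upwards [hΨγ, hγt.eventually hfS, hγt.eventually hfN, hγS] with t h1 h2 h3 h4
  obtain ⟨-, k, hk, hgk⟩ := h3 h4
  have hf0 := h2.1 h4
  have h5 : N (Φ (t • v)) = k⁻¹ • (t • v + ⟪e, gradient f (Φ (t • v))⟫ • e) := by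
    have h6 : t • v + ⟪e, gradient f (Φ (t • v))⟫ • e = k • N (Φ (t • v)) := by
      have h7 : gradient f (Φ (t • v)) - ⟪e, gradient f (Φ (t • v))⟫ • e +
        f (Φ (t • v)) • e = t • v := h1
      rw [hf0, zero_smul, add_zero] at h7
      rw [← hgk, eq_comm, ← sub_eq_iff_eq_add, h7]
    rw [h6, smul_smul, inv_mul_cancel₀ hk, one_smul]
  rw [h5]
  refine Submodule.smul_mem _ _ (Submodule.add_mem _ (Submodule.smul_mem _ _ ?_)
    (Submodule.smul_mem _ _ ?_)) <;> apply Submodule.subset_span <;> simp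

/-- Arbitrarily close to `p` there are two points of `S` at the same height over `T_p S`, whose
normals lie in a common plane with `N p`. -/
theorem exists_pair_same_height (hn : 2 ≤ n) (hS : IsSmoothHypersurface S) (hN : IsGaussMap S N)
    (hp : p ∈ S) (hd : DifferentiableWithinAt ℝ N S p)
    (hconv : ∀ v : tangentSpaceOf S p, v ≠ 0 → 0 < ⟪v, shapeOperator S N p v⟫)
    {W : Set (EuclideanSpace ℝ (Fin n))} (hW : W ∈ 𝓝 p) :
    ∃ x ∈ S ∩ W, ∃ y ∈ S ∩ W, x ≠ y ∧ ⟪x - y, N p⟫ = 0 ∧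
      ∀ k : ℝ, ¬ LinearIndependent ℝ ![k • N p, N x, N y] := by
  have : Nontrivial (tangentSpaceOf S p) := by
    apply Module.nontrivial_of_finrank_pos (R := ℝ)
    rw [finrank_tangentSpaceOf hS hN hp]; omega
  obtain ⟨v, hv⟩ := exists_ne (0 : tangentSpaceOf S p)
  have hv0 : (v : EuclideanSpace ℝ (Fin n)) ≠ 0 := by simpa using hv
  obtain ⟨γ, Ψ, hγ, hγ0, hγS, hΨ, hΨd, hγN⟩ := exists_curve_gaussMap_mem_span hS hN hp hd hconv
    ((mem_tangentSpaceOf_iff hS hN hp).1 v.2)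
  set e := N p with he
  have hγd : ∀ᶠ t in 𝓝 (0 : ℝ), HasDerivAt γ (deriv γ t) t := by
    have hγ1 : ContDiffAt ℝ 1 γ 0 := hγ.of_le (by simp)
    filter_upwards [hγ1.eventually (by simp)] with t ht
    exact (ht.differentiableAt (by simp)).hasDerivAt
  have hγ'c : ContinuousAt (deriv γ) 0 := by
    have h1 : ContDiffAt ℝ 0 (deriv γ) 0 := by
      have := (hγ.fderiv_right (m := 0) (by simp))
      exact this.clm_apply contDiffAt_const
    exact h1.continuousAt
  set z := deriv γ 0 with hz
  have hzd : HasDerivAt γ z 0 := hγd.self_of_nhds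
  have hzT : z ∈ tangentSpaceOf S p := by
    rw [← hγ0]; exact Submodule.subset_span (mem_tangentConeAt_of_hasDerivAt hzd hγS)
  have hz0 : z ≠ 0 := by
    intro h0
    have h1 : HasDerivAt (fun t => Ψ (γ t)) (fderiv ℝ Ψ p z) 0 := by
      have h2 : HasFDerivAt Ψ (fderiv ℝ Ψ p) (γ 0) := by rw [hγ0]; exact hΨd.hasFDerivAt
      exact h2.comp_hasDerivAt (0 : ℝ) hzd
    have h2 : HasDerivAt (fun t : ℝ => t • (v : EuclideanSpace ℝ (Fin n))) ((1 : ℝ) • v) 0 :=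
      (hasDerivAt_id (0 : ℝ)).smul_const _
    have h3 := h1.unique (h2.congr_of_eventuallyEq hΨ)
    rw [h0, map_zero, one_smul] at h3
    exact hv0 h3.symm
  set c := ⟪z, fderivWithin ℝ N S p z⟫ with hc
  have hcpos : 0 < c := by
    have h1 := hconv ⟨z, hzT⟩ (by simpa using hz0)
    rwa [Submodule.coe_inner, coe_shapeOperator hS hN hp hd] at h1
  have hNγ : HasDerivAt (fun t => N (γ t)) (fderivWithin ℝ N S p z) 0 := by
    have h1 : HasFDerivWithinAt N (fderivWithin ℝ N S p) S (γ 0) := by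
      rw [hγ0]; exact hd.hasFDerivWithinAt
    exact h1.comp_curve hzd hγS
  -- the difference quotient of `⟪γ', N ∘ γ - N p⟫`
  have hslope : Tendsto (fun t => ⟪deriv γ t, t⁻¹ • (N (γ t) - e)⟫) (𝓝[≠] 0) (𝓝 c) := by
    have h1 : Tendsto (fun t => t⁻¹ • (N (γ t) - e)) (𝓝[≠] 0) (𝓝 (fderivWithin ℝ N S p z)) := by
      have := hasDerivAt_iff_tendsto_slope.1 hNγ
      simpa [slope_fun_def, hγ0, ← he] using! this
    exact (hγ'c.tendsto.mono_left nhdsWithin_le_nhds).inner h1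
  -- As γ' t ⊥ N (γ t), ⟪γ' t, e⟫ = -⟪γ' t, N (γ t) - e⟫, which is -c t to first order. So the
  -- height has a strict local maximum at 0.
  have hneg : ∀ᶠ t in 𝓝 (0 : ℝ), t ≠ 0 → t * ⟪deriv γ t, e⟫ < 0 := by
    have h1 := hslope.eventually (lt_mem_nhds hcpos)
    rw [eventually_nhdsWithin_iff] at h1
    filter_upwards [h1, hγd.and hγS.eventually_nhds, hγS] with t ht htd htS ht0
    have h2 : ⟪deriv γ t, N (γ t)⟫ = 0 := (hN.2 _ htS).2 _ (Submodule.subset_span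
      (mem_tangentConeAt_of_hasDerivAt htd.1 htd.2))
    have h3 := ht ht0
    rw [inner_smul_right, inner_sub_right, h2] at h3
    have h4 : t * ⟪deriv γ t, e⟫ = -(t ^ 2 * (t⁻¹ * (0 - ⟪deriv γ t, e⟫))) := by
      field_simp; ring
    rw [h4]
    have : 0 < t ^ 2 := by positivity
    have := mul_pos this h3
    linarith
  have hγt : Tendsto γ (𝓝 0) (𝓝 p) := by simpa [hγ0] using hzd.continuousAt.tendsto
  obtain ⟨δ, hδ, hball⟩ := Metric.eventually_nhds_iff.1
    (hneg.and (hγd.and (hγS.and (hΨ.and (hγN.and (hγt.eventually hW))))))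
  have hr : ∀ t ∈ Set.Icc (-(δ / 2)) (δ / 2), dist t 0 < δ := by
    intro t ht
    rw [Real.dist_eq, sub_zero, abs_lt]
    constructor <;> linarith [ht.1, ht.2]
  let g : ℝ → ℝ := fun t => ⟪γ t, e⟫
  have hgd : ∀ t ∈ Set.Icc (-(δ / 2)) (δ / 2), HasDerivAt g ⟪deriv γ t, e⟫ t := by
    intro t ht
    have := (hball (hr t ht)).2.1.inner ℝ (hasDerivAt_const t e)
    simpa using this
  have hgc : ContinuousOn g (Set.Icc (-(δ / 2)) (δ / 2)) :=
    fun t ht => (hgd t ht).continuousAt.continuousWithinAt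
  have hright : g (δ / 2) < g 0 := by
    obtain ⟨s, hs, hs'⟩ := exists_hasDerivAt_eq_slope g (fun t => ⟪deriv γ t, e⟫)
      (show (0 : ℝ) < δ / 2 by linarith) (hgc.mono (Set.Icc_subset_Icc (by linarith) le_rfl))
      (fun t ht => hgd t ⟨by linarith [ht.1], ht.2.le⟩)
    have h1 := (hball (hr s ⟨by linarith [hs.1], hs.2.le⟩)).1 hs.1.ne'
    have h2 : ⟪deriv γ s, e⟫ < 0 := by nlinarith [hs.1]
    rw [hs', div_lt_iff₀ (by linarith)] at h2
    linarith
  have hleft : g (-(δ / 2)) < g 0 := by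
    obtain ⟨s, hs, hs'⟩ := exists_hasDerivAt_eq_slope g (fun t => ⟪deriv γ t, e⟫)
      (show -(δ / 2) < 0 by linarith) (hgc.mono (Set.Icc_subset_Icc le_rfl (by linarith)))
      (fun t ht => hgd t ⟨ht.1.le, by linarith [ht.2]⟩)
    have h1 := (hball (hr s ⟨hs.1.le, by linarith [hs.2]⟩)).1 hs.2.ne
    have h2 : 0 < ⟪deriv γ s, e⟫ := by nlinarith [hs.2]
    rw [hs', lt_div_iff₀ (by linarith)] at h2
    linarith
  -- A continuous injective function on an interval is strictly monotone, but both endpoints lie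
  -- below the centre.
  have hninj : ¬ Set.InjOn g (Set.Icc (-(δ / 2)) (δ / 2)) := by
    intro hinj
    have m0 : (0 : ℝ) ∈ Set.Icc (-(δ / 2)) (δ / 2) := ⟨by linarith, by linarith⟩
    rcases hgc.strictMonoOn_of_injOn_Icc' (by linarith) hinj with h | h
    · exact absurd (h m0 ⟨by linarith, le_rfl⟩ (by linarith)) hright.not_gt
    · exact absurd (h ⟨le_rfl, by linarith⟩ m0 (by linarith)) hleft.not_gt
  simp only [Set.InjOn, not_forall] at hninj
  obtain ⟨s, hs, t, ht, hst, hne⟩ := hninj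
  obtain ⟨-, -, hsS, hsΨ, hsN, hsW⟩ := hball (hr s hs)
  obtain ⟨-, -, htS, htΨ, htN, htW⟩ := hball (hr t ht)
  refine ⟨γ s, ⟨hsS, hsW⟩, γ t, ⟨htS, htW⟩, ?_, ?_, ?_⟩
  · intro h
    rw [h, htΨ] at hsΨ
    exact hne (smul_left_injective ℝ hv0 hsΨ).symm
  · rw [inner_sub_left]; exact sub_eq_zero.2 hst
  · intro k hli
    have h1 : Submodule.span ℝ (Set.range ![k • e, N (γ s), N (γ t)]) ≤
        Submodule.span ℝ {e, (v : EuclideanSpace ℝ (Fin n))} := by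
      rw [Submodule.span_le]
      rintro _ ⟨i, rfl⟩
      fin_cases i
      · exact Submodule.smul_mem _ _ (Submodule.subset_span (by simp))
      · exact hsN
      · exact htN
    have h2 := Submodule.finrank_mono h1
    rw [finrank_span_eq_card hli] at h2
    have h3 := finrank_span_finset_le_card (R := ℝ) ({e, (v : EuclideanSpace ℝ (Fin n))} : Finset _)
    have h4 := Finset.card_le_two (a := e) (b := (v : EuclideanSpace ℝ (Fin n)))
    rw [Fintype.card_fin] at h2
    have h5 : finrank ℝ (Submodule.span ℝ {e, (v : EuclideanSpace ℝ (Fin n))}) ≤ 2 := by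
      rw [Finset.coe_pair] at h3
      exact h3.trans h4
    omega

end Curve

/-! ### Coplanar unit vectors; ⟪a, b⟫ ^ 2 ≠ 1 expresses that a and b are not parallel -/

section UnitVectors

open Module

variable {V : Type*} [NormedAddCommGroup V] [InnerProductSpace ℝ V]

theorem eq_inner_smul_of_inner_sq_eq_one {a b : V} (ha : ‖a‖ = 1) (hb : ‖b‖ = 1)
    (h : ⟪a, b⟫ ^ 2 = 1) : b = ⟪a, b⟫ • a := by
  have haa : ⟪a, a⟫ = 1 := by rw [real_inner_self_eq_norm_sq, ha]; norm_num
  have hbb : ⟪b, b⟫ = 1 := by rw [real_inner_self_eq_norm_sq, hb]; norm_num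
  rw [← sub_eq_zero, ← inner_self_eq_zero (𝕜 := ℝ)]
  simp only [inner_sub_left, inner_sub_right, inner_smul_left, inner_smul_right, haa, hbb,
    real_inner_comm a b, conj_trivial]
  linarith

theorem exists_eq_add_of_not_linearIndependent {a b c : V} (ha : ‖a‖ = 1) (hb : ‖b‖ = 1)
    (hab : ⟪a, b⟫ ^ 2 ≠ 1) (h : ¬ LinearIndependent ℝ ![a, b, c]) :
    ∃ α β : ℝ, c = α • a + β • b := by
  have haa : ⟪a, a⟫ = 1 := by rw [real_inner_self_eq_norm_sq, ha]; norm_num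
  have hbb : ⟪b, b⟫ = 1 := by rw [real_inner_self_eq_norm_sq, hb]; norm_num
  obtain ⟨g, hg, i, hi⟩ := Fintype.not_linearIndependent_iff.1 h
  rw [Fin.sum_univ_three] at hg
  change g 0 • a + g 1 • b + g 2 • c = 0 at hg
  by_cases h2 : g 2 = 0
  · exfalso
    rw [h2, zero_smul, add_zero] at hg
    have h3 := congrArg (fun x => ⟪a, x⟫) hg
    have h4 := congrArg (fun x => ⟪b, x⟫) hg
    simp only [inner_add_right, inner_smul_right, haa, hbb, inner_zero_right,
      real_inner_comm a b] at h3 h4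
    have h5 : g 1 * (1 - ⟪a, b⟫ ^ 2) = 0 := by linear_combination h4 - ⟪a, b⟫ * h3
    have h6 : g 1 = 0 := (mul_eq_zero.1 h5).resolve_right (fun h => hab (by linarith))
    have h7 : g 0 = 0 := by rw [h6] at h3; linarith
    fin_cases i
    · exact hi h7
    · exact hi h6
    · exact hi h2
  · refine ⟨-(g 2)⁻¹ * g 0, -(g 2)⁻¹ * g 1, ?_⟩
    have h3 : g 2 • c = -(g 0 • a + g 1 • b) := by
      rw [eq_neg_iff_add_eq_zero, add_comm]; exact hg
    have h4 : c = (g 2)⁻¹ • (g 2 • c) := by rw [smul_smul, inv_mul_cancel₀ h2, one_smul]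
    rw [h4, h3]
    module

theorem not_linearIndependent_of_smul_add_eq_zero {a b c : V} (x y z : ℝ)
    (h : x • a + y • b + z • c = 0) (hz : z ≠ 0) : ¬ LinearIndependent ℝ ![a, b, c] := by
  rw [Fintype.not_linearIndependent_iff]
  exact ⟨![x, y, z], by simpa [Fin.sum_univ_three] using h, 2, by simpa using hz⟩

end UnitVectors

/-! ### Nondegeneracy, symmetry and first-order relations of third points -/

section ThirdPoint

open Module Filter Topology

variable {n : ℕ} {S : Set (EuclideanSpace ℝ (Fin n))}
  {N : EuclideanSpace ℝ (Fin n) → EuclideanSpace ℝ (Fin n)}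
  {p u u' u'' : EuclideanSpace ℝ (Fin n)}

theorem wedgeNorm_comm (a b : EuclideanSpace ℝ (Fin n)) : wedgeNorm a b = wedgeNorm b a := by
  rw [wedgeNorm, wedgeNorm, real_inner_comm, mul_comm]

theorem wedgeNorm_sq {a b : EuclideanSpace ℝ (Fin n)} (ha : ‖a‖ = 1) (hb : ‖b‖ = 1) :
    wedgeNorm a b ^ 2 = 1 - ⟪a, b⟫ ^ 2 := by
  have h := abs_real_inner_le_norm a b
  rw [ha, hb, one_mul, ← sq_le_one_iff_abs_le_one] at h
  rw [wedgeNorm, Real.sq_sqrt] <;> rw [ha, hb] <;> linarith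

theorem wedgeNorm_pos {a b : EuclideanSpace ℝ (Fin n)} (ha : ‖a‖ = 1) (hb : ‖b‖ = 1)
    (hab : ⟪a, b⟫ ^ 2 ≠ 1) : 0 < wedgeNorm a b := by
  refine lt_of_le_of_ne (Real.sqrt_nonneg _) fun h => hab ?_
  have := wedgeNorm_sq ha hb
  rw [← h] at this
  linarith

/-- If `c = α a + β b` then `|a ∧ c| = |β| |a ∧ b|`. -/
theorem wedgeNorm_eq_abs_mul {a b c : EuclideanSpace ℝ (Fin n)} (ha : ‖a‖ = 1) (hb : ‖b‖ = 1)
    (hc : ‖c‖ = 1) {α β : ℝ} (h : c = α • a + β • b) :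
    wedgeNorm a c = |β| * wedgeNorm a b := by
  have haa : ⟪a, a⟫ = 1 := by rw [real_inner_self_eq_norm_sq, ha]; norm_num
  have hbb : ⟪b, b⟫ = 1 := by rw [real_inner_self_eq_norm_sq, hb]; norm_num
  have hcc : ⟪c, c⟫ = 1 := by rw [real_inner_self_eq_norm_sq, hc]; norm_num
  refine (sq_eq_sq₀ (Real.sqrt_nonneg _) (mul_nonneg (abs_nonneg _) (Real.sqrt_nonneg _))).1 ?_
  rw [mul_pow, sq_abs]
  change wedgeNorm a c ^ 2 = β ^ 2 * wedgeNorm a b ^ 2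
  rw [wedgeNorm_sq ha hc, wedgeNorm_sq ha hb]
  have h1 : ⟪a, c⟫ = α + β * ⟪a, b⟫ := by
    rw [h, inner_add_right, inner_smul_right, inner_smul_right, haa]; ring
  rw [h] at hcc
  simp only [inner_add_left, inner_add_right, inner_smul_left, inner_smul_right, haa, hbb,
    real_inner_comm a b, conj_trivial] at hcc
  rw [h1]
  linear_combination -hcc

theorem thirdPoint_mem {q : EuclideanSpace ℝ (Fin n)} (hq : q ∈ S) : thirdPoint S N p q ∈ S := by
  unfold thirdPoint
  split_ifs with h
  · exact h.choose_spec.2.1.1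
  · exact hq

theorem isThirdPoint_of_thirdPoint_ne {q : EuclideanSpace ℝ (Fin n)}
    (h : thirdPoint S N p q ≠ q) : IsThirdPoint S N p q (thirdPoint S N p q) := by
  unfold thirdPoint at h ⊢
  split_ifs at h ⊢ with h'
  · exact h'.choose_spec
  · exact absurd rfl h

/-- A third point differs from u', whereas u' is the default value of `thirdPoint`; by continuity
the default is not taken near u. -/
theorem IsThirdPoint.eventually_left (h : IsThirdPoint S N u u' u'')
    (hc : ContinuousWithinAt (fun p => thirdPoint S N p u') S u) :
    ∀ᶠ p in 𝓝[S] u, IsThirdPoint S N p u' (thirdPoint S N p u') := by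
  have h1 : (fun p => thirdPoint S N p u') u ≠ u' := by
    simp only [h.thirdPoint_eq]; exact h.2.1.2.1
  filter_upwards [hc.eventually_ne h1] with p hp using isThirdPoint_of_thirdPoint_ne hp

theorem IsThirdPoint.eventually_right (h : IsThirdPoint S N u u' u'')
    (hc : ContinuousWithinAt (fun p => thirdPoint S N u p) S u') :
    ∀ᶠ p in 𝓝[S] u', IsThirdPoint S N u p (thirdPoint S N u p) := by
  have h1 : ∀ᶠ p in 𝓝[S] u', thirdPoint S N u p - p ≠ 0 := by
    refine (hc.sub continuousWithinAt_id).eventually_ne ?_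
    change thirdPoint S N u u' - u' ≠ 0
    rw [h.thirdPoint_eq]
    exact sub_ne_zero.2 h.2.1.2.1
  filter_upwards [h1] with p hp using isThirdPoint_of_thirdPoint_ne (sub_ne_zero.1 hp)

/-- The normals at `u` and `u'` are not parallel if the third point exists: close to a `u'` with
parallel normals, third points would be close to `u'` as well. -/
theorem IsThirdPoint.inner_sq_ne_one_left (hn : 2 ≤ n) (hS : IsSmoothHypersurface S)
    (hN : IsGaussMap S N) (hu : u ∈ S) (hu' : u' ∈ S)
    (hconv : ∀ v : tangentSpaceOf S u', v ≠ 0 → 0 < ⟪v, shapeOperator S N u' v⟫)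
    (h : IsThirdPoint S N u u' u'')
    (hc : ContinuousWithinAt (fun p => thirdPoint S N u p) S u') : ⟪N u, N u'⟫ ^ 2 ≠ 1 := by
  intro hpar
  have hpar' : N u = ⟪N u', N u⟫ • N u' := by
    apply eq_inner_smul_of_inner_sq_eq_one (hN.2 _ hu').1 (hN.2 _ hu).1
    rwa [real_inner_comm]
  -- W surrounds u' and V surrounds u''. Continuity puts the third point of x in V, but uniqueness
  -- makes it y, which lies in W.
  obtain ⟨W, V, hW, hV, hWV⟩ := t2_separation_nhds h.2.1.2.1.symm
  have hVF : ∀ᶠ p in 𝓝[S] u', thirdPoint S N u p ∈ V := by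
    have h1 : V ∈ 𝓝 (thirdPoint S N u u') := by rwa [h.thirdPoint_eq]
    exact hc h1
  obtain ⟨W', hW', hsub⟩ := mem_nhdsWithin_iff_exists_mem_nhds_inter.1 hVF
  obtain ⟨x, ⟨hxS, hxW, hxW'⟩, y, ⟨hyS, hyW, -⟩, hxy, hh, hli⟩ :=
    exists_pair_same_height hn hS hN hu' (differentiableWithinAt_gaussMap hn hS hN hu' hconv) hconv
      (inter_mem hW hW')
  have hFx : thirdPoint S N u x ∈ V := hsub ⟨hxW', hxS⟩
  have hne : thirdPoint S N u x ≠ x := fun h0 =>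
    Set.disjoint_left.1 hWV hxW (by rwa [h0] at hFx)
  have hy : y = thirdPoint S N u x := by
    refine (isThirdPoint_of_thirdPoint_ne hne).2.2 y ⟨hyS, hxy.symm, ?_, ?_⟩
    · rw [hpar', inner_smul_right, hh, mul_zero]
    · rw [hpar']; exact hli _
  exact Set.disjoint_left.1 hWV hyW (by rwa [hy])

/-- Differentiate (p - R_u p) · N(u) = 0 in p. -/
theorem IsThirdPoint.inner_fderivWithin_right {F' : EuclideanSpace ℝ (Fin n) →L[ℝ] _}
    (hu' : u' ∈ S) (h : IsThirdPoint S N u u' u'')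
    (hF : HasFDerivWithinAt (fun p => thirdPoint S N u p) F' S u') {v : EuclideanSpace ℝ (Fin n)}
    (hv : v ∈ tangentSpaceOf S u') : ⟪F' v, N u⟫ = ⟪v, N u⟫ := by
  have hc := hasFDerivWithinAt_const (𝕜 := ℝ) (N u) u' S
  have h1 := (hF.inner ℝ hc).eqOn_tangentSpaceOf ((hasFDerivWithinAt_id u' S).inner ℝ hc) hu'
    (by
      filter_upwards [h.eventually_right hF.continuousWithinAt] with p hp
      have := hp.2.1.2.2.1
      rw [inner_sub_left] at this
      simp only [id]; linarith) hv
  simpa [fderivInnerCLM_apply] using h1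

/-- Differentiate (u' - R_p u') · N(p) = 0 in p; here the normal varies too. -/
theorem IsThirdPoint.inner_fderivWithin_left {F' : EuclideanSpace ℝ (Fin n) →L[ℝ] _}
    (hu : u ∈ S) (h : IsThirdPoint S N u u' u'') (hd : DifferentiableWithinAt ℝ N S u)
    (hF : HasFDerivWithinAt (fun p => thirdPoint S N p u') F' S u) {v : EuclideanSpace ℝ (Fin n)}
    (hv : v ∈ tangentSpaceOf S u) : ⟪F' v, N u⟫ = ⟪u' - u'', fderivWithin ℝ N S u v⟫ := by
  have hc := hasFDerivWithinAt_const (𝕜 := ℝ) u' u S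
  have h1 := ((hc.sub hF).inner ℝ hd.hasFDerivWithinAt).eqOn_tangentSpaceOf
    (hasFDerivWithinAt_const (0 : ℝ) u S) hu
    (by
      filter_upwards [h.eventually_left hF.continuousWithinAt] with p hp using hp.2.1.2.2.1) hv
  simp [fderivInnerCLM_apply, h.thirdPoint_eq] at h1
  linarith

theorem IsThirdPoint.inner_sq_ne_one_right (hS : IsSmoothHypersurface S)
    (hN : IsGaussMap S N) (hu : u ∈ S) (hu' : u' ∈ S)
    (h : IsThirdPoint S N u u' u'') (hpar : ⟪N u, N u'⟫ ^ 2 ≠ 1)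
    (hF : DifferentiableWithinAt ℝ (fun p => thirdPoint S N u p) S u') :
    ⟪N u, N u''⟫ ^ 2 ≠ 1 := by
  intro h1
  have hu'' : u'' ∈ S := h.2.1.1
  have h2 : N u = ⟪N u'', N u⟫ • N u'' := by
    apply eq_inner_smul_of_inner_sq_eq_one (hN.2 _ hu'').1 (hN.2 _ hu).1
    rwa [real_inner_comm]
  -- The tangential part of N u at u'. Its height along N u is 1 - ⟪N u, N u'⟫ ^ 2, while its image
  -- is tangent at u'' and so has height 0.
  set v := N u - ⟪N u', N u⟫ • N u' with hv
  have hvT : v ∈ tangentSpaceOf S u' := by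
    rw [mem_tangentSpaceOf_iff hS hN hu', hv, inner_sub_right, inner_smul_right,
      hN.inner_self hu']
    ring
  have h3 := h.inner_fderivWithin_right hu' hF.hasFDerivWithinAt hvT
  have h4 := hF.hasFDerivWithinAt.mapsTo_tangentSpaceOf (fun p hp => thirdPoint_mem hp) hvT
  simp only [h.thirdPoint_eq] at h4
  rw [mem_tangentSpaceOf_iff hS hN hu'', real_inner_comm] at h4
  rw [h2, inner_smul_right, h4, ← h2, hv, inner_sub_left, inner_smul_left,
    hN.inner_self hu, real_inner_comm (N u) (N u')] at h3
  simp only [conj_trivial] at h3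
  apply hpar
  linarith

/-- When N u is parallel to neither N u' nor N u'', the plane of N u and N u' is also that of N u
and N u''. A competitor z ≠ u' for the pair (u, u'') would thus be a third point of (u, u'), hence
equal to u''. -/
theorem IsThirdPoint.symm (hN : IsGaussMap S N) (hu : u ∈ S) (hu' : u' ∈ S)
    (h : IsThirdPoint S N u u' u'') (h₁ : ⟪N u, N u'⟫ ^ 2 ≠ 1) (h₂ : ⟪N u, N u''⟫ ^ 2 ≠ 1) :
    IsThirdPoint S N u u'' u' := by
  have hu'' : u'' ∈ S := h.2.1.1
  have hn := fun q hq => (hN.2 q hq).1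
  obtain ⟨α, β, hαβ⟩ := exists_eq_add_of_not_linearIndependent (hn u hu) (hn u' hu') h₁ h.2.1.2.2.2
  have hβ : β ≠ 0 := by
    rintro rfl
    rw [zero_smul, add_zero] at hαβ
    have h3 := hN.inner_self hu''
    rw [hαβ] at h3 h₂
    simp only [inner_smul_left, inner_smul_right, hN.inner_self hu, conj_trivial] at h3 h₂
    apply h₂; linarith
  refine ⟨?_, ⟨hu', h.2.1.2.1.symm, ?_, ?_⟩, ?_⟩
  · rintro rfl
    exact h₂ (by rw [hN.inner_self hu]; norm_num)
  · have := h.2.1.2.2.1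
    rw [inner_sub_left] at this ⊢; linarith
  · apply not_linearIndependent_of_smul_add_eq_zero α (-1) β _ hβ
    rw [hαβ]; module
  · rintro z ⟨hz, hzu, hh, hli⟩
    by_contra hne
    obtain ⟨a, b, hab⟩ := exists_eq_add_of_not_linearIndependent (hn u hu) (hn u'' hu'') h₂ hli
    refine hzu (h.2.2 z ⟨hz, hne, ?_, ?_⟩)
    · have := h.2.1.2.2.1
      rw [inner_sub_left] at this hh ⊢; linarith
    · apply not_linearIndependent_of_smul_add_eq_zero (a + b * α) (b * β) (-1) _ (by norm_num)
      rw [hab, hαβ]; module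

/-- Differentiating a linear relation `Y ∈ span {X, c}` in directions orthogonal to the span. -/
theorem inner_fderivWithin_of_mem_span
    {X Y : EuclideanSpace ℝ (Fin n) → EuclideanSpace ℝ (Fin n)}
    {X' Y' : EuclideanSpace ℝ (Fin n) →L[ℝ] EuclideanSpace ℝ (Fin n)}
    {c x v : EuclideanSpace ℝ (Fin n)} {α β : ℝ} (hp : p ∈ S)
    (hX : HasFDerivWithinAt X X' S p) (hY : HasFDerivWithinAt Y Y' S p)
    (hXY : ∀ᶠ q in 𝓝[S] p, ∃ a b : ℝ, Y q = a • X q + b • c)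
    (hαβ : Y p = α • X p + β • c) (hD : ⟪X p, X p⟫ * ⟪c, c⟫ - ⟪X p, c⟫ ^ 2 ≠ 0)
    (hxc : ⟪c, x⟫ = 0) (hxX : ⟪X p, x⟫ = 0) (hv : v ∈ tangentSpaceOf S p) :
    ⟪Y' v, x⟫ = α * ⟪X' v, x⟫ := by
  have hx := hasFDerivWithinAt_const (𝕜 := ℝ) x p S
  have hc := differentiableWithinAt_const (𝕜 := ℝ) (s := S) (x := p) c
  have hXd := hX.differentiableWithinAt
  have hYd := hY.differentiableWithinAt
  -- By Cramer's rule a = E / D with Gram determinant D. Differentiating ⟪Y, x⟫ D = ⟪X, x⟫ E needs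
  -- no regularity of a and b, and the terms with dD and dE vanish because x is orthogonal to X p
  -- and Y p.
  have hDd : DifferentiableWithinAt ℝ (fun q => ⟪X q, X q⟫ * ⟪c, c⟫ - ⟪X q, c⟫ ^ 2) S p :=
    ((hXd.inner ℝ hXd).mul_const _).sub ((hXd.inner ℝ hc).pow 2)
  have hEd : DifferentiableWithinAt ℝ (fun q => ⟪Y q, X q⟫ * ⟪c, c⟫ - ⟪Y q, c⟫ * ⟪X q, c⟫) S p :=
    ((hYd.inner ℝ hXd).mul_const _).sub ((hYd.inner ℝ hc).mul (hXd.inner ℝ hc))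
  have h1 := ((hY.inner ℝ hx).mul hDd.hasFDerivWithinAt).eqOn_tangentSpaceOf
    ((hX.inner ℝ hx).mul hEd.hasFDerivWithinAt) hp
    (by
      filter_upwards [hXY] with q hq
      obtain ⟨a, b, hab⟩ := hq
      simp only [Pi.mul_apply, hab, inner_add_left, inner_smul_left, hxc, conj_trivial,
        real_inner_comm (X q) c]
      ring) hv
  have hYx : ⟪Y p, x⟫ = 0 := by
    rw [hαβ, inner_add_left, inner_smul_left, inner_smul_left, hxc, hxX]; simp
  have hE : ⟪Y p, X p⟫ * ⟪c, c⟫ - ⟪Y p, c⟫ * ⟪X p, c⟫ =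
      α * (⟪X p, X p⟫ * ⟪c, c⟫ - ⟪X p, c⟫ ^ 2) := by
    rw [hαβ]
    simp only [inner_add_left, inner_smul_left, conj_trivial, real_inner_comm (X p) c]
    ring
  simp only [smul_apply, hYx, hxX, hE,
    zero_smul, smul_eq_mul, ContinuousLinearMap.comp_apply, ContinuousLinearMap.prod_apply,
    fderivInnerCLM_apply, zero_apply, inner_zero_right, zero_add] at h1
  have h2 : (⟪X p, X p⟫ * ⟪c, c⟫ - ⟪X p, c⟫ ^ 2) * (⟪Y' v, x⟫ - α * ⟪X' v, x⟫) = 0 := by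
    linear_combination h1
  exact sub_eq_zero.1 ((mul_eq_zero.1 h2).resolve_left hD)

end ThirdPoint

/-! ### The Jacobian of a map determined by normals and one height -/

section Jacobian

open Module

variable {n : ℕ} {S : Set (EuclideanSpace ℝ (Fin n))}
  {N : EuclideanSpace ℝ (Fin n) → EuclideanSpace ℝ (Fin n)}
  {p q e : EuclideanSpace ℝ (Fin n)}

theorem gaussCurvature_pos
    (hconv : ∀ v : tangentSpaceOf S p, v ≠ 0 → 0 < ⟪v, shapeOperator S N p v⟫) :
    0 < gaussCurvature S N p :=
  det_pos_of_inner_pos hconv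

theorem isUnit_shapeOperator
    (hconv : ∀ v : tangentSpaceOf S p, v ≠ 0 → 0 < ⟪v, shapeOperator S N p v⟫) :
    IsUnit (shapeOperator S N p) := by
  rw [LinearMap.isUnit_iff_isUnit_det]
  exact (det_pos_of_inner_pos hconv).ne'.isUnit

theorem shapeOperator_inverse_apply
    (hconv : ∀ v : tangentSpaceOf S p, v ≠ 0 → 0 < ⟪v, shapeOperator S N p v⟫)
    (v : tangentSpaceOf S p) :
    shapeOperator S N p (Ring.inverse (shapeOperator S N p) v) = v :=
  LinearMap.congr_fun (Ring.mul_inverse_cancel _ (isUnit_shapeOperator hconv)) v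

theorem inverse_shapeOperator_apply
    (hconv : ∀ v : tangentSpaceOf S p, v ≠ 0 → 0 < ⟪v, shapeOperator S N p v⟫)
    (v : tangentSpaceOf S p) :
    Ring.inverse (shapeOperator S N p) (shapeOperator S N p v) = v :=
  LinearMap.congr_fun (Ring.inverse_mul_cancel _ (isUnit_shapeOperator hconv)) v

/-- With w = dN⁻¹ (P e) the form is ⟪dN w, w⟫, and w ≠ 0 because e is not normal to S. -/
theorem invShapeForm_pos (hS : IsSmoothHypersurface S) (hN : IsGaussMap S N) (hp : p ∈ S)
    (hconv : ∀ v : tangentSpaceOf S p, v ≠ 0 → 0 < ⟪v, shapeOperator S N p v⟫)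
    (he : ‖e‖ = 1) (hep : ⟪e, N p⟫ ^ 2 ≠ 1) : 0 < invShapeForm S N p e := by
  set a := (tangentSpaceOf S p).orthogonalProjectionOnto e with ha
  set w := Ring.inverse (shapeOperator S N p) a with hw
  have hAw : shapeOperator S N p w = a := shapeOperator_inverse_apply hconv a
  have hw0 : w ≠ 0 := by
    intro h0
    rw [h0, map_zero] at hAw
    rw [← hAw, eq_comm, Submodule.orthogonalProjectionOnto_eq_zero_iff, tangentSpaceOf_eq hS hN hp,
      Submodule.orthogonal_orthogonal, Submodule.mem_span_singleton] at ha
    obtain ⟨c, rfl⟩ := ha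
    rw [norm_smul, (hN.2 p hp).1, mul_one, Real.norm_eq_abs] at he
    apply hep
    rw [inner_smul_left, hN.inner_self hp, conj_trivial, mul_one, ← sq_abs, he, one_pow]
  have h := hconv w hw0
  rw [hAw, real_inner_comm] at h
  exact h

/-- If `a` and `b` are unit vectors, the tangent spaces orthogonal to them are identified by an
isometry which is the identity on the common part `{a, τ}ᗮ`. -/
theorem exists_tangent_isometry (hS : IsSmoothHypersurface S) (hN : IsGaussMap S N)
    (hp : p ∈ S) (hq : q ∈ S) {τ : EuclideanSpace ℝ (Fin n)}
    (hspan : ∀ x, ⟪N p, x⟫ = 0 → ⟪τ, x⟫ = 0 → ⟪N q, x⟫ = 0) :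
    ∃ θ : tangentSpaceOf S p ≃ₗᵢ[ℝ] tangentSpaceOf S q,
      (∀ x : tangentSpaceOf S p, ⟪τ, x⟫ = 0 → (θ x : EuclideanSpace ℝ (Fin n)) = x) ∧
      ∀ t : tangentSpaceOf S p, (t : EuclideanSpace ℝ (Fin n)) = τ → ∀ r,
        ⟪N q, r⟫ = 0 → ⟪(θ t : EuclideanSpace ℝ (Fin n)), r⟫ = 0 →
        ⟪N p, r⟫ = 0 ∧ ⟪τ, r⟫ = 0 := by
  -- The reflection exchanging the two normals fixes every vector orthogonal to both.
  let ρ := (ℝ ∙ (N p - N q))ᗮ.reflection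
  have hρp : ρ (N p) = N q :=
    Submodule.reflection_sub (by rw [(hN.2 p hp).1, (hN.2 q hq).1])
  have hρx : ∀ x, ⟪N p, x⟫ = 0 → ⟪τ, x⟫ = 0 → ρ x = x := by
    intro x h1 h2
    apply Submodule.reflection_mem_subspace_eq_self
    rw [Submodule.mem_orthogonal_singleton_iff_inner_right, inner_sub_left, h1, hspan x h1 h2,
      sub_zero]
  have hmap : (tangentSpaceOf S p).map (ρ : EuclideanSpace ℝ (Fin n) →ₗ[ℝ]
      EuclideanSpace ℝ (Fin n)) = tangentSpaceOf S q := by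
    ext x
    rw [Submodule.mem_map, mem_tangentSpaceOf_iff hS hN hq]
    constructor
    · rintro ⟨y, hy, rfl⟩
      rw [mem_tangentSpaceOf_iff hS hN hp] at hy
      rw [← hρp, ← hy]
      exact ρ.inner_map_map _ _
    · intro hx
      refine ⟨ρ.symm x, ?_, by simp⟩
      rw [mem_tangentSpaceOf_iff hS hN hp, ← ρ.inner_map_map, hρp, ρ.apply_symm_apply, hx]
  let θ : tangentSpaceOf S p ≃ₗᵢ[ℝ] tangentSpaceOf S q :=
    (ρ.submoduleMap (tangentSpaceOf S p)).trans (LinearIsometryEquiv.ofEq _ _ hmap)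
  have hθ : ∀ x, (θ x : EuclideanSpace ℝ (Fin n)) = ρ x := fun x => rfl
  refine ⟨θ, fun x hx => ?_, fun t ht r hr1 hr2 => ?_⟩
  · rw [hθ, hρx x ((mem_tangentSpaceOf_iff hS hN hp).1 x.2) hx]
  · rw [hθ, ht] at hr2
    have h1 : ⟪N p, ρ.symm r⟫ = 0 := by
      rw [← ρ.inner_map_map, hρp, ρ.apply_symm_apply, hr1]
    have h2 : ⟪τ, ρ.symm r⟫ = 0 := by
      rw [← ρ.inner_map_map, ρ.apply_symm_apply, hr2]
    have h3 := hρx _ h1 h2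
    rw [ρ.apply_symm_apply] at h3
    exact ⟨by rw [h3]; exact h1, by rw [h3]; exact h2⟩

/-- The Jacobian of a map `G` of `S` to itself, when `dG` is given modulo the plane spanned by
`N p` and `τ`, in terms of the normals, together with its component along `e`. -/
theorem tangentialJacobian_mul (hn : 2 ≤ n) (hS : IsSmoothHypersurface S) (hN : IsGaussMap S N)
    (hconv : ∀ p ∈ S, ∀ v : tangentSpaceOf S p, v ≠ 0 → 0 < ⟪v, shapeOperator S N p v⟫)
    (hp : p ∈ S) (hq : q ∈ S) {G : EuclideanSpace ℝ (Fin n) → EuclideanSpace ℝ (Fin n)}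
    (hG : DifferentiableWithinAt ℝ G S p) (hGS : Set.MapsTo G S S) (hGp : G p = q)
    {τ : EuclideanSpace ℝ (Fin n)} (hτ : ‖τ‖ = 1)
    (hspan : ∀ x, ⟪N p, x⟫ = 0 → ⟪τ, x⟫ = 0 → ⟪N q, x⟫ = 0 ∧ ⟪e, x⟫ = 0)
    (he : ‖e‖ = 1) {γ : ℝ} {φ : tangentSpaceOf S p →ₗ[ℝ] ℝ}
    (h₁ : ∀ v ∈ tangentSpaceOf S p, ∀ x, ⟪N p, x⟫ = 0 → ⟪τ, x⟫ = 0 →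
      ⟪fderivWithin ℝ N S q (fderivWithin ℝ G S p v), x⟫ = γ * ⟪fderivWithin ℝ N S p v, x⟫)
    (h₂ : ∀ v : tangentSpaceOf S p, ⟪fderivWithin ℝ G S p v, e⟫ = φ (shapeOperator S N p v))
    (t : tangentSpaceOf S p) (ht : (t : EuclideanSpace ℝ (Fin n)) = τ) :
    tangentialJacobian S G p * (|invShapeForm S N q e| * gaussCurvature S N q) =
      |γ| ^ (n - 2) * |φ t| * gaussCurvature S N p * wedgeNorm e (N q) := by
  have hdp := differentiableWithinAt_gaussMap hn hS hN hp (hconv p hp)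
  have hdq := differentiableWithinAt_gaussMap hn hS hN hq (hconv q hq)
  obtain ⟨θ, hθx, hθr⟩ := exists_tangent_isometry hS hN hp hq
    (fun x h h' => (hspan x h h').1)
  have hGmem : ∀ v : tangentSpaceOf S p, fderivWithin ℝ G S p v ∈ tangentSpaceOf S q := by
    intro v
    rw [← hGp]
    exact hG.hasFDerivWithinAt.mapsTo_tangentSpaceOf hGS v.2
  let D : tangentSpaceOf S p →ₗ[ℝ] tangentSpaceOf S q :=
    (tangentialDeriv S G p).codRestrict _ hGmem
  let B : End ℝ (tangentSpaceOf S p) := θ.symm.toLinearEquiv.toLinearMap ∘ₗ D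
  have hB : ∀ v, θ (B v) = D v := fun v => θ.apply_symm_apply _
  have hDc : ∀ v, (D v : EuclideanSpace ℝ (Fin n)) = fderivWithin ℝ G S p v := fun v => rfl
  have hjac : tangentialJacobian S G p = |LinearMap.det B| := by
    apply sqrt_det_adjoint_comp_self _
      ((tangentSpaceOf S q).subtypeₗᵢ.comp θ.toLinearIsometry)
    intro v
    change _ = (θ (B v) : EuclideanSpace ℝ (Fin n))
    rw [hB]; rfl
  set A₂ := shapeOperator S N q with hA₂
  let C := θ.symm.toLinearEquiv.toLinearMap ∘ₗ A₂ ∘ₗ θ.toLinearEquiv.toLinearMap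
  let C' := θ.symm.toLinearEquiv.toLinearMap ∘ₗ Ring.inverse A₂ ∘ₗ θ.toLinearEquiv.toLinearMap
  have hC : ∀ y, θ (C y) = A₂ (θ y) := fun y => θ.apply_symm_apply _
  have hC' : ∀ y, θ (C' y) = Ring.inverse A₂ (θ y) := fun y => θ.apply_symm_apply _
  have hdetC : LinearMap.det C = gaussCurvature S N q :=
    LinearMap.det_conj A₂ θ.symm.toLinearEquiv
  let ψ : tangentSpaceOf S p →ₗ[ℝ] ℝ :=
    (innerSL ℝ e : EuclideanSpace ℝ (Fin n) →ₗ[ℝ] ℝ) ∘ₗ (tangentSpaceOf S q).subtype ∘ₗ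
      θ.toLinearEquiv.toLinearMap
  have hψ : ∀ y, ψ y = ⟪(θ y : EuclideanSpace ℝ (Fin n)), e⟫ := fun y => by
    change ⟪e, (θ y : EuclideanSpace ℝ (Fin n))⟫ = _
    exact real_inner_comm _ _
  have htn : ‖t‖ = 1 := by rw [Submodule.coe_norm, ht, hτ]
  have hCC : C' ∘ₗ C = LinearMap.id := by
    refine LinearMap.ext fun y => ?_
    apply θ.injective
    rw [LinearMap.comp_apply, hC', hC, inverse_shapeOperator_apply (hconv q hq)]
    rfl
  have key := det_mul_of_prescribed (τ := t) htn (γ := γ) (A₁ := shapeOperator S N p)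
    (A₂ := C) (A₂' := C') (D := B) (φ := φ) (ψ := ψ) hCC
    (by
      intro v x hx
      rw [Submodule.coe_inner, ht] at hx
      rw [← θ.inner_map_map, hC, hB, Submodule.coe_inner, hA₂, coe_shapeOperator hS hN hq hdq,
        hθx x hx, Submodule.coe_inner, coe_shapeOperator hS hN hp hdp]
      exact h₁ v v.2 x ((mem_tangentSpaceOf_iff hS hN hp).1 x.2) hx)
    (by
      intro v
      rw [hψ, hB, hDc, h₂])
  -- the projection of `e` to the tangent space at `q` is a multiple of `θ t`
  set κ := ⟪(θ t : EuclideanSpace ℝ (Fin n)), e⟫ with hκ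
  have hθt : ⟪(θ t : EuclideanSpace ℝ (Fin n)), (θ t : EuclideanSpace ℝ (Fin n))⟫ = 1 := by
    rw [← Submodule.coe_inner, θ.inner_map_map, real_inner_self_eq_norm_sq, htn]; norm_num
  have hθN : ⟪N q, (θ t : EuclideanSpace ℝ (Fin n))⟫ = 0 :=
    (mem_tangentSpaceOf_iff hS hN hq).1 (θ t).2
  have hNN := hN.inner_self hq
  -- The remainder is orthogonal to N q and θ t, hence to N p and τ, hence to e; so it has norm
  -- zero.
  have hdec : e = ⟪N q, e⟫ • N q + κ • (θ t : EuclideanSpace ℝ (Fin n)) := by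
    rw [← sub_eq_zero]
    set r := e - (⟪N q, e⟫ • N q + κ • (θ t : EuclideanSpace ℝ (Fin n))) with hr
    have hr1 : ⟪N q, r⟫ = 0 := by
      rw [hr]
      simp only [inner_sub_right, inner_add_right, inner_smul_right, hNN, hθN]
      ring
    have hr2 : ⟪(θ t : EuclideanSpace ℝ (Fin n)), r⟫ = 0 := by
      rw [hr]
      simp only [inner_sub_right, inner_add_right, inner_smul_right, hθt,
        real_inner_comm (N q) _, hθN, hκ]
      ring
    obtain ⟨h3, h4⟩ := hθr t ht r hr1 hr2
    have h5 := (hspan r h3 h4).2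
    rw [← inner_self_eq_zero (𝕜 := ℝ)]
    nth_rewrite 1 [hr]
    rw [inner_sub_left, inner_add_left, inner_smul_left, inner_smul_left, h5, hr1, hr2]
    simp
  have hκw : wedgeNorm e (N q) = |κ| := by
    rw [← abs_of_nonneg (show 0 ≤ wedgeNorm e (N q) from Real.sqrt_nonneg _), ← sq_eq_sq_iff_abs_eq_abs,
      wedgeNorm_sq he (hN.2 q hq).1]
    have h1 : ⟪e, e⟫ = 1 := by rw [real_inner_self_eq_norm_sq, he]; norm_num
    have h2 : ⟪e, e⟫ = ⟪N q, e⟫ * ⟪N q, e⟫ + κ * κ := by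
      nth_rewrite 1 [hdec]
      rw [inner_add_left, inner_smul_left, inner_smul_left]
      rfl
    rw [real_inner_comm]
    linarith
  have hproj : (tangentSpaceOf S q).orthogonalProjectionOnto e = κ • θ t := by
    have h1 : (tangentSpaceOf S q).orthogonalProjectionOnto (N q) = 0 := by
      rw [Submodule.orthogonalProjectionOnto_eq_zero_iff, tangentSpaceOf_eq hS hN hq,
        Submodule.orthogonal_orthogonal]
      exact Submodule.mem_span_singleton_self _
    rw [hdec, map_add, map_smul, map_smul, h1, smul_zero, zero_add,
      Submodule.orthogonalProjectionOnto_mem_subspace_eq_self]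
  have hinv : invShapeForm S N q e = κ * ψ (C' t) := by
    have h1 : ψ (C' t) = κ * ⟪θ t, Ring.inverse A₂ (θ t)⟫ := by
      rw [hψ, hC']
      have h2 : ⟪N q, (Ring.inverse A₂ (θ t) : EuclideanSpace ℝ (Fin n))⟫ = 0 :=
        (mem_tangentSpaceOf_iff hS hN hq).1 (Ring.inverse A₂ (θ t)).2
      nth_rewrite 1 [hdec]
      rw [inner_add_right, inner_smul_right, inner_smul_right, real_inner_comm (N q) _, h2,
        mul_zero, zero_add, real_inner_comm (θ t : EuclideanSpace ℝ (Fin n)) _,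
        Submodule.coe_inner]
    rw [h1, invShapeForm, hproj, map_smul, inner_smul_left, inner_smul_right]
    rfl
  rw [finrank_tangentSpaceOf hS hN hp, hdetC, Nat.sub_sub] at key
  have key' := congrArg abs key
  simp only [abs_mul, abs_pow] at key'
  rw [abs_of_pos (gaussCurvature_pos (hconv q hq)),
    abs_of_pos (show 0 < LinearMap.det (shapeOperator S N p) from
      gaussCurvature_pos (hconv p hp))] at key'
  rw [hjac, hinv, hκw, abs_mul]
  simp only [gaussCurvature] at key' ⊢
  -- The factor |κ| is |e ∧ N q|; it also turns ψ (C' t) into the inverse shape form, as the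
  -- projection of e is κ • θ t.
  linear_combination |κ| * key'

end Jacobian

/-! ### The Jacobians of the two third-point maps -/

section ThirdPointJacobian

open Module Filter Topology

variable {n : ℕ} {S : Set (EuclideanSpace ℝ (Fin n))}
  {N : EuclideanSpace ℝ (Fin n) → EuclideanSpace ℝ (Fin n)}
  {p c u u' u'' : EuclideanSpace ℝ (Fin n)}

/-- The unit tangent vector at `p` in the direction of the projection of `c`. -/
theorem exists_unit_tangent (hS : IsSmoothHypersurface S) (hN : IsGaussMap S N) (hp : p ∈ S)
    (hc : ‖c‖ = 1) (hcp : ⟪N p, c⟫ ^ 2 ≠ 1) :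
    ∃ t : tangentSpaceOf S p, ‖t‖ = 1 ∧
      c = ⟪N p, c⟫ • N p + wedgeNorm (N p) c • (t : EuclideanSpace ℝ (Fin n)) := by
  have hw := wedgeNorm_pos (hN.2 p hp).1 hc hcp
  have hw2 := wedgeNorm_sq (hN.2 p hp).1 hc
  set w := wedgeNorm (N p) c
  have hmem : c - ⟪N p, c⟫ • N p ∈ tangentSpaceOf S p := by
    rw [mem_tangentSpaceOf_iff hS hN hp, inner_sub_right, inner_smul_right, hN.inner_self hp]
    ring
  have hcc : ⟪c, c⟫ = 1 := by rw [real_inner_self_eq_norm_sq, hc]; norm_num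
  have hnorm : ‖c - ⟪N p, c⟫ • N p‖ = w := by
    rw [← sq_eq_sq₀ (norm_nonneg _) hw.le, hw2, ← real_inner_self_eq_norm_sq]
    simp only [inner_sub_left, inner_sub_right, inner_smul_left, inner_smul_right, hcc,
      hN.inner_self hp, real_inner_comm (N p) c, conj_trivial]
    ring
  refine ⟨w⁻¹ • ⟨_, hmem⟩, ?_, ?_⟩
  · rw [norm_smul, Submodule.coe_norm, hnorm, Real.norm_eq_abs, abs_of_pos (inv_pos.2 hw),
      inv_mul_cancel₀ hw.ne']
  · rw [Submodule.coe_smul, smul_smul, mul_inv_cancel₀ hw.ne', one_smul, add_sub_cancel]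

theorem eventually_inner_sq_ne_one (hN : IsGaussMap S N) (hp : p ∈ S) (hcp : ⟪N p, c⟫ ^ 2 ≠ 1) :
    ∀ᶠ q in 𝓝[S] p, ⟪N q, c⟫ ^ 2 ≠ 1 :=
  (((hN.1 p hp).inner continuousWithinAt_const).pow 2).eventually_ne hcp

theorem IsThirdPoint.inner_sub_eq (h : IsThirdPoint S N u u' u'') {α β : ℝ}
    (hαβ : N u'' = α • N u + β • N u') : ⟪u'' - u', N u''⟫ = -(β * ⟪u' - u'', N u'⟫) := by
  rw [← neg_sub u' u'', inner_neg_left, hαβ, inner_add_right, inner_smul_right, inner_smul_right,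
    h.2.1.2.2.1]
  ring

/-- Here γ = α, τ is the direction of N u' in T_u S, and φ = ⟪u' - u'', ·⟫. Since u' - u'' is
orthogonal to N u, φ τ times |N u ∧ N u''| is ⟪u'' - u', N u''⟫ up to sign. -/
theorem jacobianJ_mul (hn : 2 ≤ n) (hS : IsSmoothHypersurface S) (hN : IsGaussMap S N)
    (hconv : ∀ p ∈ S, ∀ v : tangentSpaceOf S p, v ≠ 0 → 0 < ⟪v, shapeOperator S N p v⟫)
    (hu : u ∈ S) (hu' : u' ∈ S) (h : IsThirdPoint S N u u' u'')
    (hd : DifferentiableWithinAt ℝ (fun p => thirdPoint S N p u') S u)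
    (h₁ : ⟪N u, N u'⟫ ^ 2 ≠ 1) :
    jacobianJ S N u u' * (|invShapeForm S N u'' (N u)| * gaussCurvature S N u'') =
      (wedgeNorm (N u') (N u'') / wedgeNorm (N u) (N u')) ^ (n - 2) *
        |⟪u'' - u', N u''⟫| * gaussCurvature S N u := by
  have hu'' : u'' ∈ S := h.2.1.1
  have hnorm := fun q hq => (hN.2 q hq).1
  have hdN := fun q hq => differentiableWithinAt_gaussMap hn hS hN hq (hconv q hq)
  obtain ⟨α, β, hαβ⟩ :=
    exists_eq_add_of_not_linearIndependent (hnorm u hu) (hnorm u' hu') h₁ h.2.1.2.2.2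
  obtain ⟨t, ht, htc⟩ := exists_unit_tangent hS hN hu (hnorm u' hu') h₁
  have hw := wedgeNorm_pos (hnorm u hu) (hnorm u' hu') h₁
  have hN'' : ∀ x, ⟪N u, x⟫ = 0 → ⟪(t : EuclideanSpace ℝ (Fin n)), x⟫ = 0 →
      ⟪N u', x⟫ = 0 ∧ ⟪N u'', x⟫ = 0 := by
    intro x hx hx'
    have h3 : ⟪N u', x⟫ = 0 := by
      rw [htc, inner_add_left, inner_smul_left, inner_smul_left, hx, hx']; simp
    refine ⟨h3, ?_⟩
    rw [hαβ, inner_add_left, inner_smul_left, inner_smul_left, hx, h3]; simp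
  have hG : HasFDerivWithinAt (fun p => N (thirdPoint S N p u'))
      ((fderivWithin ℝ N S u'').comp (fderivWithin ℝ (fun p => thirdPoint S N p u') S u)) S u := by
    have h3 : HasFDerivWithinAt N (fderivWithin ℝ N S u'') S (thirdPoint S N u u') := by
      rw [h.thirdPoint_eq]; exact (hdN u'' hu'').hasFDerivWithinAt
    exact h3.comp u hd.hasFDerivWithinAt fun p _ => thirdPoint_mem hu'
  have key := tangentialJacobian_mul hn hS hN hconv hu hu'' hd (fun p _ => thirdPoint_mem hu')
    h.thirdPoint_eq (τ := t) (by rw [← Submodule.coe_norm, ht])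
    (fun x hx hx' => ⟨(hN'' x hx hx').2, hx⟩) (hnorm u hu) (γ := α)
    (φ := (innerSL ℝ (u' - u'') : EuclideanSpace ℝ (Fin n) →ₗ[ℝ] ℝ) ∘ₗ
      (tangentSpaceOf S u).subtype)
    (by
      intro v hv x hx hx'
      refine inner_fderivWithin_of_mem_span (c := N u') (β := β) hu (hdN u hu).hasFDerivWithinAt hG
        ?_ ?_ ?_ (hN'' x hx hx').1 hx hv
      · filter_upwards [eventually_inner_sq_ne_one hN hu h₁, self_mem_nhdsWithin,
          h.eventually_left hd.continuousWithinAt] with q hq hqS hq3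
        exact exists_eq_add_of_not_linearIndependent (hnorm q hqS) (hnorm u' hu') hq
          hq3.2.1.2.2.2
      · simp only [h.thirdPoint_eq, hαβ]
      · rw [hN.inner_self hu, hN.inner_self hu', one_mul]
        exact fun h0 => h₁ (by linarith))
    (by
      intro v
      rw [h.inner_fderivWithin_left hu (hdN u hu) hd.hasFDerivWithinAt v.2]
      simp [coe_shapeOperator hS hN hu (hdN u hu), inner_sub_left])
    t rfl
  have hαw : wedgeNorm (N u') (N u'') / wedgeNorm (N u) (N u') = |α| := by
    rw [wedgeNorm_eq_abs_mul (hnorm u' hu') (hnorm u hu) (hnorm u'' hu'') (α := β) (β := α)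
      (by rw [hαβ, add_comm]), wedgeNorm_comm (N u') (N u), mul_div_assoc, div_self hw.ne', mul_one]
  have hβw : wedgeNorm (N u) (N u'') = |β| * wedgeNorm (N u) (N u') :=
    wedgeNorm_eq_abs_mul (hnorm u hu) (hnorm u' hu') (hnorm u'' hu'') hαβ
  have hinner : |⟪u'' - u', N u''⟫| =
      |⟪u' - u'', (t : EuclideanSpace ℝ (Fin n))⟫| * wedgeNorm (N u) (N u'') := by
    have h4 : ⟪u' - u'', N u'⟫ =
        wedgeNorm (N u) (N u') * ⟪u' - u'', (t : EuclideanSpace ℝ (Fin n))⟫ := by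
      nth_rewrite 1 [htc]
      rw [inner_add_right, inner_smul_right, inner_smul_right, h.2.1.2.2.1]; ring
    have h5 : ⟪u'' - u', N u''⟫ = -(β * ⟪u' - u'', N u'⟫) := h.inner_sub_eq hαβ
    rw [h5, h4, hβw, abs_neg, abs_mul, abs_mul, abs_of_pos hw]; ring
  rw [jacobianJ, key, hαw, hinner]
  simp only [LinearMap.comp_apply, Submodule.subtype_apply, ContinuousLinearMap.coe_coe,
    innerSL_apply_apply]
  ring

/-- Here γ = β, τ is the direction of N u in T_{u'} S, and φ = ⟪N u, dN⁻¹ ·⟫ turns the conserved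
height into a function of dN v. The identity |N u ∧ N u''| = |β| |N u ∧ N u'| raises the exponent n
- 2 to n - 1 and completes φ τ to the inverse shape form at u'. -/
theorem jacobianDelta_mul (hn : 2 ≤ n) (hS : IsSmoothHypersurface S) (hN : IsGaussMap S N)
    (hconv : ∀ p ∈ S, ∀ v : tangentSpaceOf S p, v ≠ 0 → 0 < ⟪v, shapeOperator S N p v⟫)
    (hu : u ∈ S) (hu' : u' ∈ S) (h : IsThirdPoint S N u u' u'')
    (hd : DifferentiableWithinAt ℝ (fun p => thirdPoint S N u p) S u')
    (h₁ : ⟪N u, N u'⟫ ^ 2 ≠ 1) :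
    jacobianDelta S N u u' * (|invShapeForm S N u'' (N u)| * gaussCurvature S N u'') =
      (wedgeNorm (N u) (N u'') / wedgeNorm (N u) (N u')) ^ (n - 1) *
        |invShapeForm S N u' (N u)| * gaussCurvature S N u' := by
  have hu'' : u'' ∈ S := h.2.1.1
  have hnorm := fun q hq => (hN.2 q hq).1
  have hdN := fun q hq => differentiableWithinAt_gaussMap hn hS hN hq (hconv q hq)
  obtain ⟨α, β, hαβ⟩ :=
    exists_eq_add_of_not_linearIndependent (hnorm u hu) (hnorm u' hu') h₁ h.2.1.2.2.2
  have h₁' : ⟪N u', N u⟫ ^ 2 ≠ 1 := by rwa [real_inner_comm]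
  obtain ⟨t, ht, htc⟩ := exists_unit_tangent hS hN hu' (hnorm u hu) h₁'
  have hw := wedgeNorm_pos (hnorm u hu) (hnorm u' hu') h₁
  rw [wedgeNorm_comm (N u') (N u)] at htc
  set w := wedgeNorm (N u) (N u') with hwdef
  have hspan : ∀ x, ⟪N u', x⟫ = 0 → ⟪(t : EuclideanSpace ℝ (Fin n)), x⟫ = 0 →
      ⟪N u'', x⟫ = 0 ∧ ⟪N u, x⟫ = 0 := by
    intro x hx hx'
    have h3 : ⟪N u, x⟫ = 0 := by
      rw [htc, inner_add_left, inner_smul_left, inner_smul_left, hx, hx']; simp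
    refine ⟨?_, h3⟩
    rw [hαβ, inner_add_left, inner_smul_left, inner_smul_left, hx, h3]; simp
  have hG : HasFDerivWithinAt (fun p => N (thirdPoint S N u p))
      ((fderivWithin ℝ N S u'').comp (fderivWithin ℝ (fun p => thirdPoint S N u p) S u')) S u' := by
    have h3 : HasFDerivWithinAt N (fderivWithin ℝ N S u'') S (thirdPoint S N u u') := by
      rw [h.thirdPoint_eq]; exact (hdN u'' hu'').hasFDerivWithinAt
    exact h3.comp u' hd.hasFDerivWithinAt fun p hp => thirdPoint_mem hp
  let φ : tangentSpaceOf S u' →ₗ[ℝ] ℝ :=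
    (innerSL ℝ (N u) : EuclideanSpace ℝ (Fin n) →ₗ[ℝ] ℝ) ∘ₗ (tangentSpaceOf S u').subtype ∘ₗ
      Ring.inverse (shapeOperator S N u')
  have key := tangentialJacobian_mul hn hS hN hconv hu' hu'' hd (fun p hp => thirdPoint_mem hp)
    h.thirdPoint_eq (τ := t) (by rw [← Submodule.coe_norm, ht]) hspan (hnorm u hu) (γ := β) (φ := φ)
    (by
      intro v hv x hx hx'
      refine inner_fderivWithin_of_mem_span (c := N u) (β := α) hu' (hdN u' hu').hasFDerivWithinAt
        hG ?_ ?_ ?_ (hspan x hx hx').2 hx hv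
      · filter_upwards [eventually_inner_sq_ne_one hN hu' h₁', self_mem_nhdsWithin,
          h.eventually_right hd.continuousWithinAt] with q hq hqS hq3
        rw [real_inner_comm] at hq
        obtain ⟨a, b, hab⟩ := exists_eq_add_of_not_linearIndependent (hnorm u hu) (hnorm q hqS) hq
          hq3.2.1.2.2.2
        exact ⟨b, a, by rw [hab, add_comm]⟩
      · simp only [h.thirdPoint_eq]
        rw [hαβ, add_comm]
      · rw [hN.inner_self hu, hN.inner_self hu', one_mul]
        exact fun h0 => h₁' (by linarith))
    (by
      intro v
      rw [h.inner_fderivWithin_right hu' hd.hasFDerivWithinAt v.2, real_inner_comm]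
      change _ = ⟪N u, (Ring.inverse (shapeOperator S N u') (shapeOperator S N u' v) :
        EuclideanSpace ℝ (Fin n))⟫
      rw [inverse_shapeOperator_apply (hconv u' hu')])
    t rfl
  have hβw : wedgeNorm (N u) (N u'') = |β| * w :=
    wedgeNorm_eq_abs_mul (hnorm u hu) (hnorm u' hu') (hnorm u'' hu'') hαβ
  have hφ : invShapeForm S N u' (N u) = w * φ t := by
    have h1 : (tangentSpaceOf S u').orthogonalProjectionOnto (N u') = 0 := by
      rw [Submodule.orthogonalProjectionOnto_eq_zero_iff, tangentSpaceOf_eq hS hN hu',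
        Submodule.orthogonal_orthogonal]
      exact Submodule.mem_span_singleton_self _
    have h2 : (tangentSpaceOf S u').orthogonalProjectionOnto (N u) = w • t := by
      rw [htc, map_add, map_smul, map_smul, h1, smul_zero, zero_add,
        Submodule.orthogonalProjectionOnto_mem_subspace_eq_self]
    have h3 : φ t = ⟪(tangentSpaceOf S u').orthogonalProjectionOnto (N u),
        Ring.inverse (shapeOperator S N u') t⟫ := by
      rw [Submodule.inner_orthogonalProjectionOnto_eq_of_mem_right]; rfl
    rw [h3, invShapeForm, h2, map_smul, inner_smul_right]
  rw [jacobianDelta, key, hφ, hβw, mul_div_assoc, div_self hw.ne', mul_one, abs_mul,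
    abs_of_pos hw, show n - 1 = n - 2 + 1 by omega, pow_succ]
  ring

/-- Both sides are the component of `u'' - u'` in the plane of the normals. -/
theorem IsThirdPoint.abs_inner_mul_wedgeNorm (hN : IsGaussMap S N) (hu : u ∈ S) (hu' : u' ∈ S)
    (h : IsThirdPoint S N u u' u'') (h₁ : ⟪N u, N u'⟫ ^ 2 ≠ 1) :
    |⟪u'' - u', N u''⟫| * wedgeNorm (N u) (N u') =
      |⟪u' - u'', N u'⟫| * wedgeNorm (N u) (N u'') := by
  have hnorm := fun q hq => (hN.2 q hq).1
  obtain ⟨α, β, hαβ⟩ :=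
    exists_eq_add_of_not_linearIndependent (hnorm u hu) (hnorm u' hu') h₁ h.2.1.2.2.2
  have h5 : ⟪u'' - u', N u''⟫ = -(β * ⟪u' - u'', N u'⟫) := h.inner_sub_eq hαβ
  rw [wedgeNorm_eq_abs_mul (hnorm u hu) (hnorm u' hu') (hnorm u'' h.2.1.1) hαβ, h5, abs_neg,
    abs_mul]
  ring

end ThirdPointJacobian

/-! ### The theorem -/

theorem proposition4p2 {n : ℕ} (hn : 2 ≤ n)
    (S : Set (EuclideanSpace ℝ (Fin n)))
    (N : EuclideanSpace ℝ (Fin n) → EuclideanSpace ℝ (Fin n))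
    (hS : IsSmoothHypersurface S) (hN : IsGaussMap S N)
    -- strict convexity: the shape operator is positive definite at every point
    (hconv : ∀ p ∈ S, ∀ v : tangentSpaceOf S p, v ≠ 0 → 0 < ⟪v, shapeOperator S N p v⟫)
    -- the maps `p ↦ R_p u'` and `p ↦ R_u p` are differentiable away from `u = u'`
    (hdiff₁ : ∀ u ∈ S, ∀ u' ∈ S, (∃ w, IsThirdPoint S N u u' w) →
      DifferentiableWithinAt ℝ (fun p => thirdPoint S N p u') S u)
    (hdiff₂ : ∀ u ∈ S, ∀ u' ∈ S, (∃ w, IsThirdPoint S N u u' w) →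
      DifferentiableWithinAt ℝ (fun p => thirdPoint S N u p) S u')
    (u u' u'' : EuclideanSpace ℝ (Fin n)) (hu : u ∈ S) (hu' : u' ∈ S)
    (hu'' : IsThirdPoint S N u u' u'') :
    -- the expressions below are well defined
    (IsThirdPoint S N u u'' u' ∧
      0 < wedgeNorm (N u) (N u') ∧ 0 < wedgeNorm (N u) (N u'') ∧
      0 < invShapeForm S N u'' (N u) ∧ 0 < gaussCurvature S N u'') ∧
    jacobianJ S N u u' =
      (wedgeNorm (N u') (N u'') / wedgeNorm (N u) (N u')) ^ (n - 2) *
        |⟪u'' - u', N u''⟫ / invShapeForm S N u'' (N u)| *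
        (gaussCurvature S N u / gaussCurvature S N u'') ∧
    jacobianDelta S N u u' =
      (wedgeNorm (N u) (N u'') / wedgeNorm (N u) (N u')) ^ (n - 1) *
        (|invShapeForm S N u' (N u)| / |invShapeForm S N u'' (N u)|) *
        (gaussCurvature S N u' / gaussCurvature S N u'') ∧
    jacobianJ S N u u' * jacobianDelta S N u u'' = jacobianJ S N u u'' := by

  have hu''S : u'' ∈ S := hu''.2.1.1
  have hnorm := fun q hq => (hN.2 q hq).1
  have hF := hdiff₂ u hu u' hu' ⟨u'', hu''⟩
  have h₁ := hu''.inner_sq_ne_one_left hn hS hN hu hu' (hconv u' hu') hF.continuousWithinAt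
  have h₂ := hu''.inner_sq_ne_one_right hS hN hu hu' h₁ hF
  have hsymm := hu''.symm hN hu hu' h₁ h₂
  have hw' := wedgeNorm_pos (hnorm u hu) (hnorm u' hu') h₁
  have hw'' := wedgeNorm_pos (hnorm u hu) (hnorm u'' hu''S) h₂
  have hq' := invShapeForm_pos hS hN hu' (hconv u' hu') (hnorm u hu) h₁
  have hq'' := invShapeForm_pos hS hN hu''S (hconv u'' hu''S) (hnorm u hu) h₂
  have hK' := gaussCurvature_pos (hconv u' hu')
  have hK'' := gaussCurvature_pos (hconv u'' hu''S)
  have hJ := jacobianJ_mul hn hS hN hconv hu hu' hu'' (hdiff₁ u hu u' hu' ⟨u'', hu''⟩) h₁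
  have hJs := jacobianJ_mul hn hS hN hconv hu hu''S hsymm (hdiff₁ u hu u'' hu''S ⟨u', hsymm⟩) h₂
  have hΔ := jacobianDelta_mul hn hS hN hconv hu hu' hu'' hF h₁
  have hΔs := jacobianDelta_mul hn hS hN hconv hu hu''S hsymm (hdiff₂ u hu u'' hu''S ⟨u', hsymm⟩) h₂
  have habs := hu''.abs_inner_mul_wedgeNorm hN hu hu' h₁
  rw [← eq_div_iff (mul_pos (abs_pos.2 hq''.ne') hK'').ne'] at hJ hΔ
  rw [← eq_div_iff (mul_pos (abs_pos.2 hq'.ne') hK').ne'] at hJs hΔs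
  refine ⟨⟨hsymm, hw', hw'', hq'', hK''⟩, ?_, ?_, ?_⟩
  · rw [hJ, abs_div]; field_simp
  · rw [hΔ]; field_simp
  -- The forms and curvatures at u'' cancel. The exponents n - 2 and n - 1 leave one factor |N u ∧ N
  -- u'| / |N u ∧ N u''|, which `habs` absorbs.
  · rw [hJ, hJs, hΔs, wedgeNorm_comm (N u'') (N u'), show n - 1 = n - 2 + 1 by omega]
    rw [abs_of_pos hq', abs_of_pos hq'']
    rw [← eq_div_iff hw'.ne'] at habs
    rw [habs]
    simp only [div_pow, pow_succ]
    field_simp
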